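/- All algebras are unital and over $\mathbb C$; $V\mathbin{\widehat\otimes}W$ is the complete projective tensor product of locally convex spaces. An Arens–Michael algebra is a complete Hausdorff topological algebra whose topology is given by submultiplicative seminorms. $\mathcal F_n$ is the Arens–Michael envelope of the free algebra in $n$ generators (the algebra of free entire functions). A Fréchet Arens–Michael algebra $A$ is holomorphically generated by $s_1,\dots,s_n\in A$ if each $a\in A$ has the form $a=\sum_w c_w s_w$, the sum over all words $w$ in $1,\dots,n$ ($s_w$ being the corresponding product), where $\sum_w|c_w|\rho^{|w|}<\infty$ for all $\rho>0$; it is holomorphically finitely generated (HFG) if it is holomorphically generated by some finite family. A Hopf $\widehat\otimes$-algebra is a Hopf algebra in the monoidal category of complete locally convex spaces with $\widehat\otimes$; it is an HFG Hopf algebra if it is also an HFG algebra. **Proposition.** Let $\hbar\in\mathbb C$ with $\sinh\hbar\neq0$. Let $\widetilde U(\mathfrak{af}_1)_\hbar$ be the universal HFG algebra generated by $X,Y$ subject to $$[X,Y]=\frac{\sinh\hbar Y}{\sinh\hbar},$$ that is, the quotient of $\mathcal F_2$ (with generators $X,Y$) by the closed two-sided ideal generated by $[X,Y]-\frac{\sinh\hbar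 Y}{\sinh\hbar}$. It is an HFG algebra, holomorphically generated by $X,Y$, which satisfy this relation, and for every Arens–Michael algebra $B$ and $x,y\in B$ with $[x,y]=\frac{\sinh\hbar y}{\sinh\hbar}$ there is a unique continuous unital homomorphism $\widetilde U(\mathfrak{af}_1)_\hbar\to B$ with $X\mapsto x$, $Y\mapsto y$. Moreover $\widetilde U(\mathfrak{af}_1)_\hbar$ is infinite-dimensional, and it is an HFG Hopf algebra with respect to a comultiplication $\Delta$ and counit $\varepsilon$ (continuous unital homomorphisms) and an antipode $S$ (a continuous unital antihomomorphism), which are uniquely determined by $$\Delta(X)=X\otimes e^{-\hbar Y}+e^{\hbar Y}\otimes X,\qquad \Delta(Y)=1\otimes Y+Y\otimes1,$$ $$S(X)=-X-\frac{\hbar}{\sinh\hbar}\sinh\hbar Y,\qquad S(Y)=-Y,\qquad \varepsilon(X)=\varepsilon(Y)=0.$$ The antipode $S$ is invertible, as a continuous linear map. -/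

import Mathlib

open scoped TensorProduct Topology
open UniformSpace

noncomputable section

/-! ### Locally convex topologies given by sets of seminorms -/

section SeminormTopology

variable {E : Type*} [AddCommGroup E] [Module ℂ E]

/-- The locally convex topology on a complex vector space determined by a set of seminorms. -/
abbrev seminormTopology (P : Set (Seminorm ℂ E)) : TopologicalSpace E :=
  (SeminormFamily.moduleFilterBasis (fun p : P => p.1)).topology

theorem seminormTopology_withSeminorms (P : Set (Seminorm ℂ E)) :
    @WithSeminorms ℂ E P _ _ _ (fun p : P => p.1) (seminormTopology P) :=
  @WithSeminorms.mk ℂ E P _ _ _ (fun p : P => p.1) (seminormTopology P) rfl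

theorem seminormTopology_isTopologicalAddGroup (P : Set (Seminorm ℂ E)) :
    @IsTopologicalAddGroup E (seminormTopology P) _ :=
  @WithSeminorms.topologicalAddGroup ℂ E P _ _ _ (seminormTopology P) _
    (seminormTopology_withSeminorms P)

/-- The (additive, translation invariant) uniform structure belonging to `seminormTopology P`. -/
abbrev seminormUniformSpace (P : Set (Seminorm ℂ E)) : UniformSpace E :=
  @IsTopologicalAddGroup.rightUniformSpace E _ (seminormTopology P)
    (seminormTopology_isTopologicalAddGroup P)

theorem seminormUniformSpace_isUniformAddGroup (P : Set (Seminorm ℂ E)) :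
    @IsUniformAddGroup E (seminormUniformSpace P) _ :=
  @isUniformAddGroup_of_addCommGroup E _ (seminormTopology P)
    (seminormTopology_isTopologicalAddGroup P)

theorem seminormTopology_continuousSMul (P : Set (Seminorm ℂ E)) :
    @ContinuousSMul ℂ E _ _ (seminormTopology P) :=
  @WithSeminorms.continuousSMul ℂ E P _ _ _ (seminormTopology P) _
    (seminormTopology_withSeminorms P)

theorem isTopologicalRing_of_withSeminorms {A ι : Type*} [Ring A] [Algebra ℂ A]
    [TopologicalSpace A] {p : SeminormFamily ℂ A ι} (hp : WithSeminorms p)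
    (h : ∀ i, ∃ s t : Seminorm ℂ A, Continuous s ∧ Continuous t ∧
      ∀ a b, p i (a * b) ≤ s a * t b) : IsTopologicalRing A := by
  have := hp.topologicalAddGroup
  refine { (inferInstance : IsTopologicalAddGroup A) with continuous_mul := ?_ }
  rw [continuous_iff_continuousAt]
  rintro ⟨a, b⟩
  refine (hp.tendsto_nhds _ _).2 ?_
  intro i ε hε
  obtain ⟨s, t, hs, ht, hst⟩ := h i
  have hlim : Filter.Tendsto (fun x : A × A => s (x.1 - a) * t (x.2 - b) + s a * t (x.2 - b)
      + s (x.1 - a) * t b) (𝓝 (a, b)) (𝓝 0) := by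
    have : Continuous (fun x : A × A => s (x.1 - a) * t (x.2 - b) + s a * t (x.2 - b)
      + s (x.1 - a) * t b) := by fun_prop
    simpa using this.tendsto (a, b)
  filter_upwards [hlim.eventually_lt_const hε] with x hx
  refine lt_of_le_of_lt ?_ hx
  have e : x.1 * x.2 - a * b = (x.1 - a) * (x.2 - b) + a * (x.2 - b) + (x.1 - a) * b := by
    noncomm_ring
  simp only [e]
  refine (map_add_le_add _ _ _).trans (add_le_add ((map_add_le_add _ _ _).trans
    (add_le_add (hst _ _) (hst _ _))) (hst _ _))

end SeminormTopology

/-! ### The complete projective tensor product -/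

section TensorSeminorm

variable {V W : Type*} [AddCommGroup V] [Module ℂ V] [AddCommGroup W] [Module ℂ W]

theorem tensorSeminorm_bddAbove (p : Seminorm ℂ V) (q : Seminorm ℂ W) :
    BddAbove {r : Seminorm ℂ (V ⊗[ℂ] W) | ∀ v w, r (v ⊗ₜ[ℂ] w) ≤ p v * q w} := by
  rw [Seminorm.bddAbove_iff, bddAbove_pi]
  intro u
  induction u using TensorProduct.induction_on with
  | zero => exact ⟨0, by rintro _ ⟨_, ⟨r, _, rfl⟩, rfl⟩; simp⟩
  | tmul v w => exact ⟨p v * q w, by rintro _ ⟨_, ⟨r, hr, rfl⟩, rfl⟩; exact hr v w⟩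
  | add x y hx hy =>
    obtain ⟨a, ha⟩ := hx
    obtain ⟨b, hb⟩ := hy
    refine ⟨a + b, ?_⟩
    rintro _ ⟨_, ⟨r, hr, rfl⟩, rfl⟩
    exact (map_add_le_add r x y).trans
      (add_le_add (ha ⟨_, ⟨r, hr, rfl⟩, rfl⟩) (hb ⟨_, ⟨r, hr, rfl⟩, rfl⟩))

/-- The largest seminorm on `V ⊗ W` with value at most `p v * q w` on each `v ⊗ w`. -/
def tensorSeminorm (p : Seminorm ℂ V) (q : Seminorm ℂ W) : Seminorm ℂ (V ⊗[ℂ] W) :=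
  sSup {r : Seminorm ℂ (V ⊗[ℂ] W) | ∀ v w, r (v ⊗ₜ[ℂ] w) ≤ p v * q w}

theorem le_tensorSeminorm {p : Seminorm ℂ V} {q : Seminorm ℂ W} {r : Seminorm ℂ (V ⊗[ℂ] W)}
    {c : ℝ} (hc : 0 ≤ c) (h : ∀ v w, r (v ⊗ₜ[ℂ] w) ≤ c * (p v * q w)) (u : V ⊗[ℂ] W) :
    r u ≤ c * tensorSeminorm p q u := by
  have hB := tensorSeminorm_bddAbove p q
  have main : ∀ d : ℝ, c < d → r u ≤ d * tensorSeminorm p q u := by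
    intro d hd
    have hd0 : 0 < d := hc.trans_lt hd
    let d' : NNReal := ⟨d⁻¹, (inv_pos.2 hd0).le⟩
    have hmem : d' • r ∈ {r : Seminorm ℂ (V ⊗[ℂ] W) | ∀ v w, r (v ⊗ₜ[ℂ] w) ≤ p v * q w} := by
      intro v w
      change d⁻¹ * r (v ⊗ₜ[ℂ] w) ≤ _
      rw [inv_mul_le_iff₀ hd0]
      exact (h v w).trans (mul_le_mul_of_nonneg_right hd.le
        (mul_nonneg (apply_nonneg _ _) (apply_nonneg _ _)))
    have h1 : (d' • r) u ≤ tensorSeminorm p q u := le_csSup hB hmem u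
    change d⁻¹ * r u ≤ _ at h1
    rwa [inv_mul_le_iff₀ hd0] at h1
  have hlim : Filter.Tendsto (fun d : ℝ => d * tensorSeminorm p q u) (𝓝[>] c)
      (𝓝 (c * tensorSeminorm p q u)) :=
    ((continuous_id.mul continuous_const).tendsto _).mono_left nhdsWithin_le_nhds
  refine ge_of_tendsto hlim ?_
  filter_upwards [self_mem_nhdsWithin] with d hd using main d hd

theorem tensorSeminorm_tmul_le (p : Seminorm ℂ V) (q : Seminorm ℂ W) (v : V) (w : W) :
    tensorSeminorm p q (v ⊗ₜ[ℂ] w) ≤ p v * q w := by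
  rw [tensorSeminorm, Seminorm.sSup_apply (tensorSeminorm_bddAbove p q)]
  have : Nonempty ↑{r : Seminorm ℂ (V ⊗[ℂ] W) | ∀ v w, r (v ⊗ₜ[ℂ] w) ≤ p v * q w} :=
    ⟨⟨0, fun v w => mul_nonneg (apply_nonneg _ _) (apply_nonneg _ _)⟩⟩
  exact ciSup_le fun r => r.2 v w

end TensorSeminorm

section Projective

variable {V W : Type*} [AddCommGroup V] [Module ℂ V] [TopologicalSpace V]
  [AddCommGroup W] [Module ℂ W] [TopologicalSpace W]

/-- A jointly continuous "bilinear seminorm" is dominated by a product of continuous seminorms. -/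
theorem exists_seminorm_mul_bound [IsTopologicalAddGroup V] [ContinuousSMul ℂ V]
    [IsTopologicalAddGroup W] [ContinuousSMul ℂ W]
    {E : Type*} [AddCommGroup E] [Module ℂ E] (β : V →ₗ[ℂ] W →ₗ[ℂ] E) (r : Seminorm ℂ E)
    (hr : Continuous fun x : V × W => r (β x.1 x.2)) :
    ∃ (p : Seminorm ℂ V) (q : Seminorm ℂ W), Continuous p ∧ Continuous q ∧
      ∀ v w, r (β v w) ≤ p v * q w := by
  have h0 : ∀ᶠ x in 𝓝 ((0 : V), (0 : W)), r (β x.1 x.2) < 1 := by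
    have := hr.tendsto ((0 : V), (0 : W))
    simp only [map_zero] at this
    exact this.eventually_lt_const one_pos
  rw [nhds_prod_eq, Filter.eventually_prod_iff] at h0
  obtain ⟨U₀, hU, V₀, hV, hUV⟩ := h0
  let P : {w // V₀ w} → Seminorm ℂ V := fun w => r.comp (β.flip w.1)
  have hPle : ∀ v, U₀ v → ∀ w, P w v ≤ 1 := fun v hv w => (hUV hv w.2).le
  have hPb : BddAbove (Set.range P) :=
    Seminorm.bddAbove_of_absorbent (s := {v | U₀ v}) (absorbent_nhds_zero (𝕜 := ℂ) hU)
      (fun v hv => ⟨1, by rintro _ ⟨w, rfl⟩; exact hPle v hv w⟩)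
  have : Nonempty {w // V₀ w} := ⟨⟨0, hV.self_of_nhds⟩⟩
  let p : Seminorm ℂ V := ⨆ w, P w
  have hp_apply : ∀ v, p v = ⨆ w, P w v := fun v => Seminorm.iSup_apply hPb
  have hPbv : ∀ v, BddAbove (Set.range fun w => P w v) := fun v => by
    obtain ⟨s, hs⟩ := hPb
    exact ⟨s v, by rintro _ ⟨w, rfl⟩; exact hs ⟨w, rfl⟩ v⟩
  have hp1 : ∀ v, U₀ v → p v ≤ 1 := fun v hv => by
    rw [hp_apply]; exact ciSup_le (hPle v hv)
  have hpc : Continuous p := by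
    refine Seminorm.continuous' (𝕜 := ℂ) (r := 1) ?_
    filter_upwards [hU] with v hv
    rw [Seminorm.mem_closedBall_zero]; exact hp1 v hv
  let Q : {v // p v ≤ 1} → Seminorm ℂ W := fun v => r.comp (β v.1)
  have hQle : ∀ w, V₀ w → ∀ v, Q v w ≤ 1 := fun w hw v => by
    refine le_trans ?_ v.2
    rw [hp_apply]
    exact le_ciSup (hPbv v.1) ⟨w, hw⟩
  have hQb : BddAbove (Set.range Q) :=
    Seminorm.bddAbove_of_absorbent (s := {w | V₀ w}) (absorbent_nhds_zero (𝕜 := ℂ) hV)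
      (fun w hw => ⟨1, by rintro _ ⟨v, rfl⟩; exact hQle w hw v⟩)
  have : Nonempty {v // p v ≤ 1} := ⟨⟨0, by simp⟩⟩
  let q : Seminorm ℂ W := ⨆ v, Q v
  have hq_apply : ∀ w, q w = ⨆ v, Q v w := fun w => Seminorm.iSup_apply hQb
  have hQbw : ∀ w, BddAbove (Set.range fun v => Q v w) := fun w => by
    obtain ⟨s, hs⟩ := hQb
    exact ⟨s w, by rintro _ ⟨v, rfl⟩; exact hs ⟨v, rfl⟩ w⟩
  have hqc : Continuous q := by
    refine Seminorm.continuous' (𝕜 := ℂ) (r := 1) ?_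
    filter_upwards [hV] with w hw
    rw [Seminorm.mem_closedBall_zero, hq_apply]; exact ciSup_le (hQle w hw)
  refine ⟨p, q, hpc, hqc, fun v w => ?_⟩
  have key : ∀ c : ℝ, p v < c → r (β v w) ≤ c * q w := by
    intro c hc
    have hc0 : 0 < c := (apply_nonneg p v).trans_lt hc
    have hv : p ((c⁻¹ : ℂ) • v) ≤ 1 := by
      rw [map_smul_eq_mul, norm_inv, Complex.norm_real, Real.norm_of_nonneg hc0.le]
      rw [inv_mul_le_iff₀ hc0]; linarith
    have h := le_ciSup (hQbw w) ⟨_, hv⟩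
    rw [← hq_apply] at h
    have h2 : Q ⟨_, hv⟩ w = c⁻¹ * r (β v w) := by
      simp only [Q, Seminorm.comp_apply, map_smul, LinearMap.smul_apply]
      rw [map_smul_eq_mul, norm_inv, Complex.norm_real, Real.norm_of_nonneg hc0.le]
    simp only [h2] at h
    rwa [inv_mul_le_iff₀ hc0] at h
  have hlim : Filter.Tendsto (fun c : ℝ => c * q w) (𝓝[>] (p v)) (𝓝 (p v * q w)) :=
    ((continuous_id.mul continuous_const).tendsto _).mono_left nhdsWithin_le_nhds
  refine ge_of_tendsto hlim ?_
  filter_upwards [self_mem_nhdsWithin] with c hc using key c hc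

variable (V W) in
/-- The seminorms `r` on `V ⊗ W` for which `(v, w) ↦ r (v ⊗ w)` is continuous on `V × W`. -/
def projectiveSeminorms : Set (Seminorm ℂ (V ⊗[ℂ] W)) :=
  {r | Continuous fun x : V × W => r (x.1 ⊗ₜ[ℂ] x.2)}

/-- The projective topology on the algebraic tensor product: the finest locally convex topology
for which the canonical bilinear map `V × W → V ⊗ W` is continuous. -/
instance projectiveUniformSpace : UniformSpace (V ⊗[ℂ] W) :=
  seminormUniformSpace (projectiveSeminorms V W)

theorem projective_withSeminorms :
    WithSeminorms (fun r : projectiveSeminorms V W => r.1) :=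
  seminormTopology_withSeminorms _

instance projective_isUniformAddGroup : IsUniformAddGroup (V ⊗[ℂ] W) :=
  seminormUniformSpace_isUniformAddGroup _

instance projective_continuousSMul : ContinuousSMul ℂ (V ⊗[ℂ] W) :=
  seminormTopology_continuousSMul _

instance projective_uniformContinuousConstSMul : UniformContinuousConstSMul ℂ (V ⊗[ℂ] W) :=
  uniformContinuousConstSMul_of_continuousConstSMul ℂ _

variable (V W) in
/-- The complete projective tensor product of two complex locally convex spaces: the (Hausdorff)
completion of the algebraic tensor product in the projective topology. -/
abbrev PTensor : Type _ := Completion (V ⊗[ℂ] W)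

/-- The elementary tensor `v ⊗ w` in the complete projective tensor product. -/
def ptmul (v : V) (w : W) : PTensor V W := ((v ⊗ₜ[ℂ] w : V ⊗[ℂ] W) : Completion (V ⊗[ℂ] W))

variable {V' W' : Type*} [AddCommGroup V'] [Module ℂ V'] [TopologicalSpace V']
  [AddCommGroup W'] [Module ℂ W'] [TopologicalSpace W']

theorem continuous_tensorMap (f : V →L[ℂ] V') (g : W →L[ℂ] W') :
    Continuous (TensorProduct.map (f : V →ₗ[ℂ] V') (g : W →ₗ[ℂ] W')) := by
  refine WithSeminorms.continuous_of_continuous_comp (projective_withSeminorms (V := V') (W := W'))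
    (TensorProduct.map (f : V →ₗ[ℂ] V') (g : W →ₗ[ℂ] W')) fun r => ?_
  refine (projective_withSeminorms (V := V) (W := W)).continuous_seminorm ⟨_, ?_⟩
  have hr : Continuous fun x : V' × W' => r.1 (x.1 ⊗ₜ[ℂ] x.2) := r.2
  exact hr.comp (f.continuous.prodMap g.continuous)

/-- The continuous linear map `f ⊗ g` between complete projective tensor products. -/
def PTensor.map (f : V →L[ℂ] V') (g : W →L[ℂ] W') : PTensor V W →L[ℂ] PTensor V' W' :=
  ContinuousLinearMap.completion
    (⟨TensorProduct.map (f : V →ₗ[ℂ] V') (g : W →ₗ[ℂ] W'), continuous_tensorMap f g⟩ :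
      V ⊗[ℂ] W →L[ℂ] V' ⊗[ℂ] W')

theorem PTensor.map_ptmul (f : V →L[ℂ] V') (g : W →L[ℂ] W') (v : V) (w : W) :
    PTensor.map f g (ptmul v w) = ptmul (f v) (g w) := by
  simp [PTensor.map, ptmul]

theorem continuous_tensorSeminorm [IsTopologicalAddGroup V] [IsTopologicalAddGroup W]
    {p : Seminorm ℂ V} {q : Seminorm ℂ W} (hp : Continuous p) (hq : Continuous q) :
    Continuous (tensorSeminorm p q) := by
  refine (projective_withSeminorms (V := V) (W := W)).continuous_seminorm
    ⟨tensorSeminorm p q, ?_⟩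
  change Continuous fun x : V × W => tensorSeminorm p q (x.1 ⊗ₜ[ℂ] x.2)
  rw [continuous_iff_continuousAt]
  rintro ⟨a, b⟩
  rw [ContinuousAt, tendsto_iff_norm_sub_tendsto_zero]
  have hlim : Filter.Tendsto (fun x : V × W => p (x.1 - a) * q (x.2 - b) + p a * q (x.2 - b)
      + p (x.1 - a) * q b) (𝓝 (a, b)) (𝓝 0) := by
    have : Continuous (fun x : V × W => p (x.1 - a) * q (x.2 - b) + p a * q (x.2 - b)
      + p (x.1 - a) * q b) := by fun_prop
    simpa using this.tendsto (a, b)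
  refine squeeze_zero (fun _ => norm_nonneg _) (fun x => ?_) hlim
  have e : x.1 ⊗ₜ[ℂ] x.2 - a ⊗ₜ[ℂ] b
      = (x.1 - a) ⊗ₜ[ℂ] (x.2 - b) + a ⊗ₜ[ℂ] (x.2 - b) + (x.1 - a) ⊗ₜ[ℂ] b := by
    simp only [TensorProduct.sub_tmul, TensorProduct.tmul_sub]; abel
  refine (abs_sub_map_le_sub (tensorSeminorm p q) _ _).trans ?_
  rw [e]
  exact (map_add_le_add _ _ _).trans (add_le_add ((map_add_le_add _ _ _).trans
    (add_le_add (tensorSeminorm_tmul_le _ _ _ _) (tensorSeminorm_tmul_le _ _ _ _)))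
    (tensorSeminorm_tmul_le _ _ _ _))

end Projective

section ProjectiveAlgebra

variable {A B : Type*} [Ring A] [Algebra ℂ A] [TopologicalSpace A] [IsTopologicalRing A]
  [ContinuousSMul ℂ A] [Ring B] [Algebra ℂ B] [TopologicalSpace B] [IsTopologicalRing B]
  [ContinuousSMul ℂ B]

/-- The multiplication `(a ⊗ b) (a' ⊗ b') = a a' ⊗ b b'` is continuous for the projective
topology. Hence `PTensor A B` is again a topological algebra. -/
instance projective_isTopologicalRing : IsTopologicalRing (A ⊗[ℂ] B) := by
  refine isTopologicalRing_of_withSeminorms (projective_withSeminorms (V := A) (W := B)) ?_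
  rintro ⟨r, hr⟩
  have hr' : Continuous fun x : A × B => r (TensorProduct.mk ℂ A B x.1 x.2) := hr
  obtain ⟨p, q, hp, hq, hpq⟩ := exists_seminorm_mul_bound (TensorProduct.mk ℂ A B) r hr'
  obtain ⟨p₁, p₂, hp₁, hp₂, hpp⟩ := exists_seminorm_mul_bound (LinearMap.mul ℂ A) p
    (hp.comp continuous_mul)
  obtain ⟨q₁, q₂, hq₁, hq₂, hqq⟩ := exists_seminorm_mul_bound (LinearMap.mul ℂ B) q
    (hq.comp continuous_mul)
  refine ⟨tensorSeminorm p₁ q₁, tensorSeminorm p₂ q₂, continuous_tensorSeminorm hp₁ hq₁,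
    continuous_tensorSeminorm hp₂ hq₂, fun u v => ?_⟩
  change r (u * v) ≤ _
  rw [mul_comm (tensorSeminorm p₁ q₁ u)]
  refine le_tensorSeminorm (r := r.comp (LinearMap.mulRight ℂ v)) (apply_nonneg _ _)
    (fun a b => ?_) u
  change r (a ⊗ₜ[ℂ] b * v) ≤ _
  rw [mul_comm (tensorSeminorm p₂ q₂ v)]
  refine le_tensorSeminorm (r := r.comp (LinearMap.mulLeft ℂ (a ⊗ₜ[ℂ] b)))
    (mul_nonneg (apply_nonneg _ _) (apply_nonneg _ _)) (fun a' b' => ?_) v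
  change r (a ⊗ₜ[ℂ] b * a' ⊗ₜ[ℂ] b') ≤ _
  rw [Algebra.TensorProduct.tmul_mul_tmul]
  calc r ((a * a') ⊗ₜ[ℂ] (b * b')) ≤ p (a * a') * q (b * b') := hpq _ _
    _ ≤ (p₁ a * p₂ a') * (q₁ b * q₂ b') :=
      mul_le_mul (hpp a a') (hqq b b') (apply_nonneg _ _)
        (mul_nonneg (apply_nonneg _ _) (apply_nonneg _ _))
    _ = _ := by ring

end ProjectiveAlgebra

/-! ### Arens-Michael algebras and holomorphically finitely generated algebras -/

/-- An Arens-Michael algebra: a complete Hausdorff topological algebra whose topology is determined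
by submultiplicative seminorms. -/
structure IsArensMichael (A : Type*) [Ring A] [Algebra ℂ A] [UniformSpace A]
    [IsUniformAddGroup A] : Prop where
  t2 : T2Space A
  complete : CompleteSpace A
  withSeminorms : WithSeminorms
    (fun p : {p : Seminorm ℂ A // Continuous p ∧ ∀ a b, p (a * b) ≤ p a * p b} => p.1)

/-- `A` is holomorphically generated by the finite family `s`: each `a : A` is the value at `s`
of a free entire function `∑_w c_w ζ_w`, where `w` runs over the words in `n` letters and
`∑_w |c_w| ρ ^ |w| < ∞` for all `ρ > 0`. -/
def IsHolomorphicallyGenerated {A : Type*} [Ring A] [Algebra ℂ A] [TopologicalSpace A] {n : ℕ}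
    (s : Fin n → A) : Prop :=
  ∀ a : A, ∃ c : FreeMonoid (Fin n) → ℂ,
    (∀ ρ : ℝ, 0 < ρ → Summable fun w => ‖c w‖ * ρ ^ w.length) ∧
    HasSum (fun w => c w • FreeMonoid.lift s w) a

/-- A holomorphically finitely generated (HFG) algebra: a Fréchet Arens-Michael algebra that is
holomorphically generated by a finite set. -/
structure IsHFG (A : Type*) [Ring A] [Algebra ℂ A] [UniformSpace A]
    [IsUniformAddGroup A] : Prop where
  arensMichael : IsArensMichael A
  metrizable : TopologicalSpace.MetrizableSpace A
  finitelyGenerated : ∃ (n : ℕ) (s : Fin n → A), IsHolomorphicallyGenerated s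

/-! ### Hopf algebras with respect to the complete projective tensor product -/

/-- `H` with comultiplication `Δ`, counit `ε` and antipode `S` is a Hopf algebra in the monoidal
category of complete (Hausdorff) locally convex spaces with the complete projective tensor product.
The linear maps `α`, `l`, `r`, `m` are uniquely determined by their values on elementary tensors:
they are the associativity isomorphism `(H ⊗ H) ⊗ H ≅ H ⊗ (H ⊗ H)`, the canonical isomorphisms
`ℂ ⊗ H ≅ H` and `H ⊗ ℂ ≅ H`, and the linearization of the multiplication. -/
structure IsHopfPTensorAlgebra {H : Type*} [Ring H] [Algebra ℂ H] [UniformSpace H]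
    [IsUniformAddGroup H] [IsTopologicalRing H] [ContinuousSMul ℂ H]
    (Δ : H →A[ℂ] PTensor H H) (ε : H →A[ℂ] ℂ) (S : H →L[ℂ] H) : Prop where
  t2 : T2Space H
  complete : CompleteSpace H
  locallyConvex : PolynormableSpace ℂ H
  coassoc : ∃ α : PTensor (PTensor H H) H →L[ℂ] PTensor H (PTensor H H),
    (∀ a b c : H, α (ptmul (ptmul a b) c) = ptmul a (ptmul b c)) ∧
    ∀ h, α (PTensor.map Δ.toContinuousLinearMap (ContinuousLinearMap.id ℂ H) (Δ h)) =
      PTensor.map (ContinuousLinearMap.id ℂ H) Δ.toContinuousLinearMap (Δ h)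
  counit_left : ∃ l : PTensor ℂ H →L[ℂ] H, (∀ (c : ℂ) (a : H), l (ptmul c a) = c • a) ∧
    ∀ h, l (PTensor.map ε.toContinuousLinearMap (ContinuousLinearMap.id ℂ H) (Δ h)) = h
  counit_right : ∃ r : PTensor H ℂ →L[ℂ] H, (∀ (a : H) (c : ℂ), r (ptmul a c) = c • a) ∧
    ∀ h, r (PTensor.map (ContinuousLinearMap.id ℂ H) ε.toContinuousLinearMap (Δ h)) = h
  antipode : ∃ m : PTensor H H →L[ℂ] H, (∀ a b : H, m (ptmul a b) = a * b) ∧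
    (∀ h, m (PTensor.map S (ContinuousLinearMap.id ℂ H) (Δ h)) = algebraMap ℂ H (ε h)) ∧
    ∀ h, m (PTensor.map (ContinuousLinearMap.id ℂ H) S (Δ h)) = algebraMap ℂ H (ε h)

/-! ### Free entire functions -/

section FreeEntire

variable (n : ℕ)

/-- All submultiplicative seminorms on the free algebra in `n` generators. -/
def freeSubmultSeminorms : Set (Seminorm ℂ (FreeAlgebra ℂ (Fin n))) :=
  {p | ∀ a b, p (a * b) ≤ p a * p b}

instance freeAlgebra_uniformSpace : UniformSpace (FreeAlgebra ℂ (Fin n)) :=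
  seminormUniformSpace (freeSubmultSeminorms n)

theorem freeAlgebra_withSeminorms :
    WithSeminorms (fun p : freeSubmultSeminorms n => p.1) :=
  seminormTopology_withSeminorms _

instance freeAlgebra_isUniformAddGroup : IsUniformAddGroup (FreeAlgebra ℂ (Fin n)) :=
  seminormUniformSpace_isUniformAddGroup _

instance freeAlgebra_continuousSMul : ContinuousSMul ℂ (FreeAlgebra ℂ (Fin n)) :=
  seminormTopology_continuousSMul _

instance freeAlgebra_uniformContinuousConstSMul :
    UniformContinuousConstSMul ℂ (FreeAlgebra ℂ (Fin n)) :=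
  uniformContinuousConstSMul_of_continuousConstSMul ℂ _

instance freeAlgebra_isTopologicalRing : IsTopologicalRing (FreeAlgebra ℂ (Fin n)) :=
  isTopologicalRing_of_withSeminorms (freeAlgebra_withSeminorms n) fun p =>
    ⟨p.1, p.1, (freeAlgebra_withSeminorms n).continuous_seminorm p,
      (freeAlgebra_withSeminorms n).continuous_seminorm p, p.2⟩

/-- The algebra of free entire functions in `n` generators: the Arens-Michael envelope of the free
algebra, i.e. its completion in the topology determined by all submultiplicative seminorms. -/
abbrev FreeEntire : Type := Completion (FreeAlgebra ℂ (Fin n))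

instance freeEntire_continuousSMul : ContinuousSMul ℂ (FreeEntire n) :=
  continuousSMul_of_algebraMap _ _ <|
    (Completion.continuous_coe (FreeAlgebra ℂ (Fin n))).comp
      (continuous_algebraMap ℂ (FreeAlgebra ℂ (Fin n)))

variable {n}

/-- The canonical generators of the algebra of free entire functions. -/
def FreeEntire.ζ (i : Fin n) : FreeEntire n :=
  ((FreeAlgebra.ι ℂ i : FreeAlgebra ℂ (Fin n)) : Completion (FreeAlgebra ℂ (Fin n)))

end FreeEntire

/-! ### Closed two-sided ideals and quotients -/

section ClosedIdeal

variable {R : Type*} [Ring R] [TopologicalSpace R]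

/-- The closed two-sided ideal generated by a set: the smallest closed two-sided ideal
containing it. -/
def closedTwoSidedSpan (s : Set R) : Ideal R :=
  sInf {J : Ideal R | J.IsTwoSided ∧ IsClosed (J : Set R) ∧ s ⊆ J}

instance closedTwoSidedSpan_isTwoSided (s : Set R) : (closedTwoSidedSpan s).IsTwoSided := by
  refine ⟨fun {a} b ha => ?_⟩
  rw [closedTwoSidedSpan, Submodule.mem_sInf] at ha ⊢
  intro J hJ
  have := hJ.1
  exact Ideal.mul_mem_right b J (ha J hJ)

end ClosedIdeal

/-! ### The deformed algebra -/

/-- `sinh a = (exp a - exp (-a)) / 2` in a topological algebra, where `exp` is the sum of the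
exponential series. -/
def algSinh {A : Type*} [Ring A] [Algebra ℂ A] [TopologicalSpace A] [IsTopologicalRing A]
    (a : A) : A :=
  (2⁻¹ : ℂ) • (NormedSpace.exp a - NormedSpace.exp (-a))

/-- The relation `[x, y] = sinh (ħ y) / sinh ħ`. -/
def AfRelation {A : Type*} [Ring A] [Algebra ℂ A] [TopologicalSpace A] [IsTopologicalRing A]
    (ħ : ℂ) (x y : A) : Prop :=
  x * y - y * x = (Complex.sinh ħ)⁻¹ • algSinh (ħ • y)

/-- The closed two-sided ideal of the algebra of free entire functions in two generators
`ζ 0`, `ζ 1` generated by `[ζ 0, ζ 1] - sinh (ħ ζ 1) / sinh ħ`. -/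
def afIdeal (ħ : ℂ) : Ideal (FreeEntire 2) :=
  closedTwoSidedSpan
    {FreeEntire.ζ 0 * FreeEntire.ζ 1 - FreeEntire.ζ 1 * FreeEntire.ζ 0
      - (Complex.sinh ħ)⁻¹ • algSinh (ħ • (FreeEntire.ζ 1 : FreeEntire 2))}

instance afIdeal_isTwoSided (ħ : ℂ) : (afIdeal ħ).IsTwoSided :=
  closedTwoSidedSpan_isTwoSided _

/-- The universal HFG algebra with generators `X`, `Y` and relation `[X, Y] = sinh (ħ Y) / sinh ħ`,
as the quotient of the algebra of free entire functions by a closed two-sided ideal, with the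
quotient topology. -/
def UAf (ħ : ℂ) : Type := FreeEntire 2 ⧸ afIdeal ħ

namespace UAf

variable (ħ : ℂ)

instance : Ring (UAf ħ) := inferInstanceAs (Ring (FreeEntire 2 ⧸ afIdeal ħ))

instance : Algebra ℂ (UAf ħ) := inferInstanceAs (Algebra ℂ (FreeEntire 2 ⧸ afIdeal ħ))

/-- The quotient homomorphism. -/
def mk : FreeEntire 2 →ₐ[ℂ] UAf ħ := Ideal.Quotient.mkₐ ℂ (afIdeal ħ)

/-- The quotient topology. -/
abbrev quotientTopology : TopologicalSpace (UAf ħ) :=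
  TopologicalSpace.coinduced (mk ħ) inferInstance

theorem quotientTopology_isTopologicalAddGroup :
    @IsTopologicalAddGroup (UAf ħ) (quotientTopology ħ) _ :=
  QuotientAddGroup.instIsTopologicalAddGroup (afIdeal ħ).toAddSubgroup

instance : UniformSpace (UAf ħ) :=
  @IsTopologicalAddGroup.rightUniformSpace (UAf ħ) _ (quotientTopology ħ)
    (quotientTopology_isTopologicalAddGroup ħ)

instance : IsUniformAddGroup (UAf ħ) :=
  @isUniformAddGroup_of_addCommGroup (UAf ħ) _ (quotientTopology ħ)
    (quotientTopology_isTopologicalAddGroup ħ)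

theorem isOpenQuotientMap_mk : IsOpenQuotientMap (mk ħ) :=
  QuotientAddGroup.isOpenQuotientMap_mk (N := (afIdeal ħ).toAddSubgroup)

instance : IsTopologicalRing (UAf ħ) where
  continuous_mul := by
    refine ((isOpenQuotientMap_mk ħ).prodMap (isOpenQuotientMap_mk ħ)).isQuotientMap
      |>.continuous_iff.2 ?_
    have : (fun p : UAf ħ × UAf ħ => p.1 * p.2) ∘ Prod.map (mk ħ) (mk ħ)
        = mk ħ ∘ fun p : FreeEntire 2 × FreeEntire 2 => p.1 * p.2 := by
      ext p; simp
    rw [this]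
    exact (isOpenQuotientMap_mk ħ).continuous.comp continuous_mul

instance : ContinuousSMul ℂ (UAf ħ) :=
  continuousSMul_of_algebraMap _ _ <| by
    have : (algebraMap ℂ (UAf ħ) : ℂ → UAf ħ) = mk ħ ∘ algebraMap ℂ (FreeEntire 2) := by
      ext c; simp
    rw [this]
    exact (isOpenQuotientMap_mk ħ).continuous.comp (continuous_algebraMap ℂ (FreeEntire 2))

/-- The generator `X`. -/
def X : UAf ħ := mk ħ (FreeEntire.ζ 0)

/-- The generator `Y`. -/
def Y : UAf ħ := mk ħ (FreeEntire.ζ 1)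

end UAf

end

/-!
The relation `[X, Y] = sinh (ħ Y) / sinh ħ` makes sense in every Arens-Michael algebra, and
`UAf ħ` is the universal solution: homomorphisms out of `FreeEntire 2` exist by
`FreeEntire.exists_lift`, and such a homomorphism factors through the quotient as soon as its values
satisfy the relation, because its kernel is then a closed two-sided ideal containing the defining
element (`UAf.exists_lift`). All parts of the Hopf structure come from this universal property.

* The topology of the free algebra is given by the countably many weighted `ℓ¹`-seminorms
  `∑_w |c_w| k ^ |w|` (`wordSeminorm_withSeminorms`). Hence `FreeEntire n` and its quotients are
  Fréchet, and every free entire function is the sum of its power series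
  (`FreeEntire.hasSum_coeff`), which gives holomorphic generation of `UAf ħ` by `X`, `Y`. In
  particular, a closed subalgebra containing `X` and `Y` is everything (`UAf.subalgebra_eq_top`),
  and this yields all uniqueness statements.
* The complete projective tensor product of Arens-Michael algebras is an Arens-Michael algebra
  (`IsLocallyMConvex.isArensMichael_pTensor`), and homomorphisms with commuting ranges extend to it
  (`PTensor.algLift`). The exponentials `exp (c Y)` are group-like (`UAf.exp_smul_primitive`), so
  the prescribed values of `Δ` satisfy the relation (`UAf.afRelation_comul`). Coassociativity and the
  counit identities are equalities of continuous homomorphisms, checked at `X` and `Y`.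
* For each `c`, there is an antiendomorphism `X ↦ -X + c sinh (ħ Y)`, `Y ↦ -Y`, obtained from the
  universal property with values in the opposite algebra (`UAf.exists_antihom`); the ones for `c`
  and `-c` are mutually inverse, whence the invertibility of the antipode, which is the case
  `c = -ħ / sinh ħ`. The elements at which the antipode identity holds form a closed subalgebra
  (`PTensor.mul_map_left_mul`), and at `X` the identity says that
  `exp (-ħ Y) X exp (ħ Y) = X + ħ sinh (ħ Y) / sinh ħ` (`UAf.exp_neg_mul_X`).
* The characters `X ↦ x`, `Y ↦ 0` show that `X` is not algebraic over `ℂ`, so that `UAf ħ` is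
  infinite-dimensional.
-/

noncomputable section

/-! ### Seminorms on completions -/

section SeminormCompletion

variable {E : Type*} [AddCommGroup E] [Module ℂ E] [UniformSpace E] [IsUniformAddGroup E]
  [UniformContinuousConstSMul ℂ E]

omit [UniformContinuousConstSMul ℂ E] in
theorem Seminorm.completion_uniformContinuous (p : Seminorm ℂ E) (hp : Continuous p) :
    UniformContinuous p :=
  Seminorm.uniformContinuous_of_continuousAt_zero hp.continuousAt

/-- The continuous extension of a continuous seminorm to the completion. -/
def Seminorm.completion (p : Seminorm ℂ E) (hp : Continuous p) : Seminorm ℂ (Completion E) :=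
  Seminorm.ofSMulLE (Completion.extension p)
    (by
      rw [← Completion.coe_zero, Completion.extension_coe (p.completion_uniformContinuous hp)]
      exact map_zero p)
    (fun x y => by
      refine Completion.induction_on₂ x y (isClosed_le ?_ ?_) fun a b => ?_
      · exact Completion.continuous_extension.comp continuous_add
      · exact (Completion.continuous_extension.comp continuous_fst).add
          (Completion.continuous_extension.comp continuous_snd)
      · rw [← Completion.coe_add]
        simp only [Completion.extension_coe (p.completion_uniformContinuous hp)]
        exact map_add_le_add p a b)
    (fun c x => by
      refine Completion.induction_on x (isClosed_le ?_ ?_) fun a => ?_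
      · exact Completion.continuous_extension.comp (continuous_const_smul c)
      · exact continuous_const.mul Completion.continuous_extension
      · rw [← Completion.coe_smul]
        simp only [Completion.extension_coe (p.completion_uniformContinuous hp)]
        exact (map_smul_eq_mul p c a).le)

theorem Seminorm.completion_coe (p : Seminorm ℂ E) (hp : Continuous p) (a : E) :
    p.completion hp (a : Completion E) = p a :=
  Completion.extension_coe (p.completion_uniformContinuous hp) a

theorem Seminorm.continuous_completion (p : Seminorm ℂ E) (hp : Continuous p) :
    Continuous (p.completion hp) :=
  Completion.continuous_extension (f := p)

/-- The topology of the completion is determined by the extended seminorms. -/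
theorem WithSeminorms.completion {ι : Type*} {p : SeminormFamily ℂ E ι} (hp : WithSeminorms p) :
    WithSeminorms (fun i => (p i).completion (hp.continuous_seminorm i)) := by
  set q : SeminormFamily ℂ (Completion E) ι :=
    fun i => (p i).completion (hp.continuous_seminorm i) with hq
  have hqc : ∀ i, Continuous (q i) := fun i => (p i).continuous_completion _
  rw [SeminormFamily.withSeminorms_iff_nhds_eq_iInf]
  refine le_antisymm (le_iInf fun i => ?_) fun U hU => ?_
  · rw [← Filter.tendsto_iff_comap]
    simpa using (hqc i).tendsto 0
  -- `V` contains the closure of the image of a seminorm ball of `E`, and the open ball `W` of the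
  -- extended seminorms lies in that closure because the image of `E` is dense.
  · obtain ⟨V, hV, hVc, hVU⟩ := exists_mem_nhds_isClosed_subset hU
    have hV' : (fun a : E => (a : Completion E)) ⁻¹' V ∈ 𝓝 (0 : E) :=
      (Completion.continuous_coe E).continuousAt.preimage_mem_nhds (by rwa [Completion.coe_zero])
    obtain ⟨⟨s, ε⟩, hε, hs⟩ := hp.hasBasis_zero_ball.mem_iff.1 hV'
    simp only at hε hs
    let W : Set (Completion E) := {x | ∀ i ∈ s, q i x < ε}
    have hWo : IsOpen W := by
      have : W = ⋂ i ∈ s, {x | q i x < ε} := by ext; simp [W]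
      rw [this]
      exact isOpen_biInter_finset fun i _ => isOpen_lt (hqc i) continuous_const
    have hWV : W ⊆ V := by
      refine (Completion.denseRange_coe.open_subset_closure_inter hWo).trans
        (closure_minimal ?_ hVc)
      rintro _ ⟨hx, a, rfl⟩
      refine hs ?_
      rw [Seminorm.mem_ball_zero]
      refine Seminorm.finset_sup_apply_lt hε fun i hi => ?_
      have := hx i hi
      rwa [hq, Seminorm.completion_coe] at this
    refine Filter.mem_of_superset ?_ (hWV.trans hVU)
    have : W = ⋂ i ∈ s, {x | q i x < ε} := by ext; simp [W]
    rw [this, Filter.biInter_finset_mem]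
    intro i _
    exact Filter.mem_iInf_of_mem i (Filter.preimage_mem_comap (m := q i) (Iio_mem_nhds hε))

end SeminormCompletion

/-! ### Locally multiplicatively convex algebras -/

section LocallyMConvex

variable {A : Type*} [Ring A] [Algebra ℂ A]

/-- A seminorm on an algebra is submultiplicative if `p (a * b) ≤ p a * p b`. No condition is
imposed on `p 1`, so that the zero seminorm is allowed. -/
def Seminorm.IsSubmultiplicative (p : Seminorm ℂ A) : Prop := ∀ a b, p (a * b) ≤ p a * p b

theorem Seminorm.IsSubmultiplicative.sup {p q : Seminorm ℂ A} (hp : p.IsSubmultiplicative)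
    (hq : q.IsSubmultiplicative) : (p ⊔ q).IsSubmultiplicative := fun a b => by
  simp only [Seminorm.sup_apply]
  refine max_le ((hp a b).trans ?_) ((hq a b).trans ?_)
  · exact mul_le_mul (le_max_left _ _) (le_max_left _ _) (apply_nonneg _ _)
      ((apply_nonneg p a).trans (le_max_left _ _))
  · exact mul_le_mul (le_max_right _ _) (le_max_right _ _) (apply_nonneg _ _)
      ((apply_nonneg p a).trans (le_max_left _ _))

theorem Seminorm.IsSubmultiplicative.finset_sup {ι : Type*} {p : ι → Seminorm ℂ A}
    (hp : ∀ i, (p i).IsSubmultiplicative) (s : Finset ι) : (s.sup p).IsSubmultiplicative := by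
  classical
  induction s using Finset.induction_on with
  | empty => intro a b; simp
  | insert i s _ ih => rw [Finset.sup_insert]; exact (hp i).sup ih

theorem Seminorm.IsSubmultiplicative.pow_succ_le {p : Seminorm ℂ A} (hp : p.IsSubmultiplicative)
    (a : A) (n : ℕ) : p (a ^ (n + 1)) ≤ p a ^ (n + 1) := by
  induction n with
  | zero => simp
  | succ n ih =>
    rw [pow_succ, pow_succ (p a)]
    exact (hp _ _).trans (mul_le_mul_of_nonneg_right ih (apply_nonneg _ _))

variable (A) in
/-- A topological algebra is locally multiplicatively convex if its topology is determined by
the continuous submultiplicative seminorms. -/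
def IsLocallyMConvex [TopologicalSpace A] : Prop :=
  WithSeminorms
    (fun p : {p : Seminorm ℂ A // Continuous p ∧ ∀ a b, p (a * b) ≤ p a * p b} => p.1)

theorem finset_sup_continuous [TopologicalSpace A] {ι : Type*}
    {p : ι → Seminorm ℂ A} (hp : ∀ i, Continuous (p i)) (s : Finset ι) :
    Continuous (⇑(s.sup p)) := by
  classical
  induction s using Finset.induction_on with
  | empty => exact continuous_const
  | insert i s _ ih =>
    rw [Finset.sup_insert]
    exact (hp i).max ih

/-- A continuous seminorm is bounded by a multiple of a single submultiplicative one, since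
submultiplicativity is preserved by finite suprema. -/
theorem IsLocallyMConvex.exists_le [TopologicalSpace A] (hA : IsLocallyMConvex A)
    (q : Seminorm ℂ A) (hq : Continuous q) :
    ∃ p : Seminorm ℂ A, Continuous p ∧ p.IsSubmultiplicative ∧
      ∃ C : ℝ, 0 ≤ C ∧ ∀ a, q a ≤ C * p a := by
  obtain ⟨s, C, _, hC⟩ := Seminorm.bound_of_continuous hA q hq
  exact ⟨_, finset_sup_continuous (fun i => i.2.1) s,
    Seminorm.IsSubmultiplicative.finset_sup (fun i => i.2.2) s, C, C.2, fun a => hC a⟩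

/-- It suffices to find a determining family of seminorms, each of which is bounded by a multiple
of a continuous submultiplicative seminorm. -/
theorem IsLocallyMConvex.of_withSeminorms [TopologicalSpace A] {ι : Type*}
    {q : SeminormFamily ℂ A ι} (hq : WithSeminorms q)
    (h : ∀ i, ∃ p : Seminorm ℂ A, Continuous p ∧ p.IsSubmultiplicative ∧
      ∃ C : ℝ, 0 ≤ C ∧ ∀ a, q i a ≤ C * p a) : IsLocallyMConvex A := by
  refine hq.congr (fun p => ?_) fun i => ?_
  · obtain ⟨s, C, _, hC⟩ := Seminorm.bound_of_continuous hq p.1 p.2.1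
    exact ⟨s, C, by simpa using hC⟩
  · obtain ⟨p, hp, hpm, C, hC0, hC⟩ := h i
    refine ⟨{⟨p, hp, hpm⟩}, ⟨C, hC0⟩, fun a => ?_⟩
    rw [Finset.sup_singleton]
    exact hC a

theorem IsLocallyMConvex.continuous_of_comp [TopologicalSpace A] (hA : IsLocallyMConvex A)
    {E : Type*} [AddCommGroup E] [Module ℂ E] [TopologicalSpace E] [IsTopologicalAddGroup E]
    (f : E →ₗ[ℂ] A)
    (h : ∀ p : Seminorm ℂ A, Continuous p → p.IsSubmultiplicative → Continuous (p.comp f)) :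
    Continuous f :=
  WithSeminorms.continuous_of_continuous_comp hA f fun p => h p.1 p.2.1 p.2.2

theorem IsLocallyMConvex.completion [UniformSpace A] [IsUniformAddGroup A]
    [IsTopologicalRing A] [UniformContinuousConstSMul ℂ A] (hA : IsLocallyMConvex A) :
    IsLocallyMConvex (Completion A) := by
  refine .of_withSeminorms (WithSeminorms.completion hA) fun p =>
    ⟨_, p.1.continuous_completion p.2.1, fun x y => ?_, 1, zero_le_one, fun a => (one_mul _).ge⟩
  have hc := p.1.continuous_completion p.2.1
  refine Completion.induction_on₂ x y (isClosed_le (hc.comp continuous_mul)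
    ((hc.comp continuous_fst).mul (hc.comp continuous_snd))) fun a b => ?_
  rw [← Completion.coe_mul]
  simp only [Seminorm.completion_coe]
  exact p.2.2 a b

theorem IsArensMichael.of_completion [UniformSpace A] [IsUniformAddGroup A]
    [IsTopologicalRing A] [UniformContinuousConstSMul ℂ A] (hA : IsLocallyMConvex A) :
    IsArensMichael (Completion A) :=
  ⟨inferInstance, inferInstance, hA.completion⟩

theorem isArensMichael_complex : IsArensMichael ℂ :=
  ⟨inferInstance, inferInstance, IsLocallyMConvex.of_withSeminorms (norm_withSeminorms ℂ ℂ) fun _ =>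
    ⟨normSeminorm ℂ ℂ, continuous_norm, fun a b => (norm_mul a b).le, 1, zero_le_one,
      fun _ => (one_mul _).ge⟩⟩

theorem IsLocallyMConvex.mulOpposite [TopologicalSpace A] (hA : IsLocallyMConvex A) :
    IsLocallyMConvex Aᵐᵒᵖ := by
  have hind : Topology.IsInducing
      ((MulOpposite.opLinearEquiv ℂ).symm : Aᵐᵒᵖ ≃ₗ[ℂ] A).toLinearMap :=
    (MulOpposite.opHomeomorph (M := A)).symm.isInducing
  refine .of_withSeminorms (hind.withSeminorms hA) fun p => ?_
  refine ⟨_, p.2.1.comp hind.continuous, fun a b => ?_, 1, zero_le_one, fun a => (one_mul _).ge⟩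
  exact (p.2.2 b.unop a.unop).trans (mul_comm _ _).le

instance MulOpposite.instIsUniformAddGroup {G : Type*} [AddGroup G] [UniformSpace G]
    [IsUniformAddGroup G] : IsUniformAddGroup Gᵐᵒᵖ :=
  IsUniformAddGroup.comap (MulOpposite.opAddEquiv.symm : Gᵐᵒᵖ ≃+ G)

theorem IsArensMichael.mulOpposite [UniformSpace A] [IsUniformAddGroup A]
    (hA : IsArensMichael A) : IsArensMichael Aᵐᵒᵖ :=
  have := hA.t2
  have := hA.complete
  ⟨inferInstance, inferInstance, IsLocallyMConvex.mulOpposite hA.withSeminorms⟩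

/-- The quotient of a locally multiplicatively convex algebra, by means of quotient seminorms. -/
theorem IsLocallyMConvex.of_isOpenQuotientMap {B : Type*} [Ring B] [Algebra ℂ B]
    [TopologicalSpace A] [TopologicalSpace B] [IsTopologicalAddGroup B] (hA : IsLocallyMConvex A)
    (f : A →ₐ[ℂ] B) (hf : IsOpenQuotientMap f) : IsLocallyMConvex B := by
  have hA0 := WithSeminorms.topologicalAddGroup hA
  choose g hg using hf.surjective
  have hbdd : ∀ (p : Seminorm ℂ A) (b : B), BddBelow (p '' (f ⁻¹' {b})) := fun p b =>
    ⟨0, by rintro _ ⟨a, _, rfl⟩; exact apply_nonneg p a⟩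
  have hne : ∀ (p : Seminorm ℂ A) (b : B), (p '' (f ⁻¹' {b})).Nonempty := fun p b =>
    ⟨_, g b, hg b, rfl⟩
  have hle : ∀ (p : Seminorm ℂ A) (a : A), sInf (p '' (f ⁻¹' {f a})) ≤ p a := fun p a =>
    csInf_le (hbdd p _) ⟨a, rfl, rfl⟩
  have hex : ∀ (p : Seminorm ℂ A) (b : B) (c : ℝ), sInf (p '' (f ⁻¹' {b})) < c →
      ∃ a, f a = b ∧ p a < c := fun p b c hc => by
    obtain ⟨_, ⟨a, ha, rfl⟩, h⟩ := exists_lt_of_csInf_lt (hne p b) hc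
    exact ⟨a, ha, h⟩
  -- `Q p` is the quotient seminorm `b ↦ inf {p a | f a = b}`.
  let Q : Seminorm ℂ A → Seminorm ℂ B := fun p =>
    Seminorm.ofSMulLE (fun b => sInf (p '' (f ⁻¹' {b})))
      (le_antisymm (by simpa using hle p 0) (Real.sInf_nonneg (by
        rintro _ ⟨a, _, rfl⟩; exact apply_nonneg p a)))
      (fun x y => le_of_forall_pos_lt_add fun ε hε => by
        obtain ⟨a, rfl, ha⟩ := hex p x _ (lt_add_of_pos_right _ (half_pos hε))
        obtain ⟨b, rfl, hb⟩ := hex p y _ (lt_add_of_pos_right _ (half_pos hε))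
        rw [← map_add]
        have := (hle p (a + b)).trans (map_add_le_add p a b)
        linarith)
      (fun c x => by
        have : Filter.Tendsto (fun d : ℝ => ‖c‖ * d) (𝓝[>] (sInf (p '' (f ⁻¹' {x}))))
            (𝓝 (‖c‖ * sInf (p '' (f ⁻¹' {x})))) :=
          ((continuous_const.mul continuous_id).tendsto _).mono_left nhdsWithin_le_nhds
        refine ge_of_tendsto this ?_
        filter_upwards [self_mem_nhdsWithin] with d hd
        obtain ⟨a, rfl, ha⟩ := hex p x d hd
        rw [← map_smul]
        refine (hle p (c • a)).trans ?_
        rw [map_smul_eq_mul]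
        exact mul_le_mul_of_nonneg_left ha.le (norm_nonneg c))
  have hQ : ∀ p b, Q p b = sInf (p '' (f ⁻¹' {b})) := fun _ _ => rfl
  have hQm : ∀ p : Seminorm ℂ A, p.IsSubmultiplicative → (Q p).IsSubmultiplicative := by
    intro p hp x y
    have : Filter.Tendsto (fun ε : ℝ => (Q p x + ε) * (Q p y + ε)) (𝓝[>] 0)
        (𝓝 ((Q p x + 0) * (Q p y + 0))) :=
      (Continuous.tendsto (by fun_prop) _).mono_left nhdsWithin_le_nhds
    simp only [add_zero] at this
    refine ge_of_tendsto this ?_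
    filter_upwards [self_mem_nhdsWithin] with ε hε
    obtain ⟨a, ha', ha⟩ := hex p x _ (lt_add_of_pos_right _ hε)
    obtain ⟨b, hb', hb⟩ := hex p y _ (lt_add_of_pos_right _ hε)
    rw [hQ p (x * y), ← ha', ← hb', ← map_mul]
    refine (hle p _).trans ((hp a b).trans ?_)
    rw [ha', hb']
    exact mul_le_mul ha.le hb.le (apply_nonneg _ _) ((apply_nonneg p a).trans ha.le)
  have hQc : ∀ p : Seminorm ℂ A, Continuous p → Continuous (Q p) := by
    intro p hp
    refine Seminorm.continuous_of_continuousAt_zero ?_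
    have h0 : 𝓝 (0 : B) = Filter.map f (𝓝 0) := by
      rw [hf.map_nhds_eq, map_zero]
    rw [ContinuousAt, map_zero, h0, Filter.tendsto_map'_iff]
    exact squeeze_zero (fun a => apply_nonneg (Q p) _) (hle p) (by simpa using hp.tendsto 0)
  have main : WithSeminorms (fun p : {p : Seminorm ℂ A //
      Continuous p ∧ ∀ a b, p (a * b) ≤ p a * p b} => Q p.1) := by
    rw [SeminormFamily.withSeminorms_iff_nhds_eq_iInf]
    refine le_antisymm (le_iInf fun p => ?_) fun U hU => ?_
    · rw [← Filter.tendsto_iff_comap]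
      simpa using (hQc p.1 p.2.1).tendsto 0
    · have hU' : f ⁻¹' U ∈ 𝓝 (0 : A) :=
        hf.continuous.continuousAt.preimage_mem_nhds (by simpa using hU)
      obtain ⟨⟨s, ε⟩, hε, hs⟩ := hA.hasBasis_zero_ball.mem_iff.1 hU'
      refine Filter.mem_of_superset (Filter.mem_iInf_of_mem ⟨_, finset_sup_continuous
        (fun i => i.2.1) s, Seminorm.IsSubmultiplicative.finset_sup (fun i => i.2.2) s⟩
        (Filter.preimage_mem_comap (Iio_mem_nhds hε))) ?_
      intro b hb
      obtain ⟨a, rfl, ha⟩ := hex _ b ε hb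
      exact hs (by rwa [Seminorm.mem_ball_zero])
  exact .of_withSeminorms main fun p =>
    ⟨_, hQc p.1 p.2.1, hQm p.1 p.2.2, 1, zero_le_one, fun a => (one_mul _).ge⟩

end LocallyMConvex

/-! ### The exponential series in Arens-Michael algebras -/

section Exponential

open NormedSpace

variable {A : Type*} [Ring A] [Algebra ℂ A] [UniformSpace A] [IsUniformAddGroup A]

/-- Absolutely convergent series converge in an Arens-Michael algebra. -/
theorem IsArensMichael.summable (hA : IsArensMichael A) {ι : Type*} {f : ι → A}
    (h : ∀ p : Seminorm ℂ A, Continuous p → p.IsSubmultiplicative → Summable fun i => p (f i)) :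
    Summable f := by
  have := hA.complete
  rw [summable_iff_vanishing]
  intro U hU
  obtain ⟨⟨s, ε⟩, hε, hs⟩ := hA.withSeminorms.hasBasis_zero_ball.mem_iff.1 hU
  simp only at hε hs
  have hsum := h _ (finset_sup_continuous (fun i => i.2.1) s)
    (Seminorm.IsSubmultiplicative.finset_sup (fun i => i.2.2) s)
  obtain ⟨t, ht⟩ := summable_iff_vanishing_norm.1 hsum ε hε
  refine ⟨t, fun t' ht' => hs ?_⟩
  rw [Seminorm.mem_ball_zero]
  refine lt_of_le_of_lt ?_ (ht t' ht')
  exact (Finset.le_sum_of_subadditive _ (map_zero _).le (map_add_le_add _) _ _).trans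
    (Real.le_norm_self _)

omit [UniformSpace A] [IsUniformAddGroup A] in
theorem Seminorm.IsSubmultiplicative.summable_exp {p : Seminorm ℂ A} (hp : p.IsSubmultiplicative)
    (x : A) : Summable fun n : ℕ => p ((n.factorial⁻¹ : ℂ) • x ^ n) := by
  -- The term `n = 0` is split off because `p 1` is not bounded by `p x ^ 0`.
  rw [← summable_nat_add_iff 1]
  refine Summable.of_nonneg_of_le (fun n => apply_nonneg p _) (fun n => ?_)
    ((summable_nat_add_iff 1).2 (Real.summable_pow_div_factorial (p x)))
  rw [map_smul_eq_mul, norm_inv, Complex.norm_natCast, inv_mul_eq_div]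
  gcongr
  exact hp.pow_succ_le x n

variable [IsTopologicalRing A]

theorem IsArensMichael.hasSum_exp (hA : IsArensMichael A) (x : A) :
    HasSum (fun n : ℕ => (n.factorial⁻¹ : ℂ) • x ^ n) (exp x) := by
  rw [exp_eq_tsum ℂ]
  exact (hA.summable fun p _ hp => hp.summable_exp x).hasSum

theorem IsArensMichael.exp_add_of_commute (hA : IsArensMichael A) {x y : A} (hxy : Commute x y) :
    exp (x + y) = exp x * exp y := by
  have := hA.t2
  have hx := hA.hasSum_exp x
  have hy := hA.hasSum_exp y
  have hprod : Summable fun k : ℕ × ℕ =>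
      ((k.1.factorial⁻¹ : ℂ) • x ^ k.1) * ((k.2.factorial⁻¹ : ℂ) • y ^ k.2) :=
    hA.summable fun p _ hp => Summable.of_nonneg_of_le (fun _ => apply_nonneg p _)
      (fun k => hp _ _) ((hp.summable_exp x).mul_of_nonneg (hp.summable_exp y)
        (fun _ => apply_nonneg p _) (fun _ => apply_nonneg p _))
  rw [← hx.tsum_eq, ← hy.tsum_eq,
    hx.summable.tsum_mul_tsum_eq_tsum_sum_antidiagonal hy.summable hprod, exp_eq_tsum ℂ]
  refine tsum_congr fun n => ?_
  rw [hxy.add_pow' _, Finset.smul_sum]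
  refine Finset.sum_congr rfl fun kl hkl => ?_
  rw [← Nat.cast_smul_eq_nsmul ℂ, smul_smul, smul_mul_smul_comm,
    ← Finset.HasAntidiagonal.mem_antidiagonal.mp hkl,
    Nat.cast_add_choose, Finset.HasAntidiagonal.mem_antidiagonal.mp hkl]
  congr 1
  field_simp [n.factorial_ne_zero]

theorem IsArensMichael.exp_neg_mul_exp (hA : IsArensMichael A) (x : A) :
    exp (-x) * exp x = 1 := by
  have := hA.t2
  rw [← hA.exp_add_of_commute (Commute.refl x).neg_left, neg_add_cancel, exp_zero]

theorem IsArensMichael.exp_mul_exp_neg (hA : IsArensMichael A) (x : A) :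
    exp x * exp (-x) = 1 := by
  have := hA.t2
  rw [← hA.exp_add_of_commute (Commute.refl x).neg_right, add_neg_cancel, exp_zero]

theorem IsArensMichael.map_exp (hA : IsArensMichael A) {B : Type*} [Ring B] [Algebra ℂ B]
    [TopologicalSpace B] [IsTopologicalRing B] [T2Space B] (φ : A →A[ℂ] B) (x : A) :
    φ (exp x) = exp (φ x) := by
  have h := (hA.hasSum_exp x).map φ φ.continuous
  rw [congrFun (exp_eq_tsum ℂ) (φ x), ← h.tsum_eq]
  exact tsum_congr fun n => by simp

theorem IsArensMichael.map_algSinh (hA : IsArensMichael A) {B : Type*} [Ring B] [Algebra ℂ B]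
    [TopologicalSpace B] [IsTopologicalRing B] [T2Space B] (φ : A →A[ℂ] B) (x : A) :
    φ (algSinh x) = algSinh (φ x) := by
  simp [algSinh, hA.map_exp]

omit [IsUniformAddGroup A] in
theorem algSinh_neg (x : A) : algSinh (-x) = -algSinh x := by
  rw [algSinh, algSinh, neg_neg, ← smul_neg, neg_sub]

omit [IsUniformAddGroup A] in
theorem algSinh_zero [T2Space A] : algSinh (0 : A) = 0 := by
  simp [algSinh]

/-- If `[x, y] = s` commutes with `y`, then `[x, exp y] = exp y * s`, because
`[x, y ^ n] = n y ^ (n - 1) s`. -/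
theorem IsArensMichael.mul_exp_sub_exp_mul (hA : IsArensMichael A) {x y s : A}
    (hs : x * y - y * x = s) (hc : Commute y s) : x * exp y - exp y * x = exp y * s := by
  have := hA.t2
  have hpow : ∀ n : ℕ, x * y ^ (n + 1) - y ^ (n + 1) * x = ((n + 1 : ℕ) : ℂ) • (y ^ n * s) := by
    intro n
    induction n with
    | zero => simp [hs]
    | succ n ih =>
      have e : x * y ^ (n + 1 + 1) - y ^ (n + 1 + 1) * x
          = (x * y ^ (n + 1) - y ^ (n + 1) * x) * y + y ^ (n + 1) * (x * y - y * x) := by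
        rw [pow_succ y (n + 1)]; noncomm_ring
      rw [e, ih, hs, smul_mul_assoc, mul_assoc, ← hc.eq, ← mul_assoc, ← pow_succ]
      push_cast
      module
  have h := hA.hasSum_exp y
  have h1 := (h.mul_left x).sub (h.mul_right x)
  have h2 : HasSum (fun n : ℕ => ((n.factorial⁻¹ : ℂ) • y ^ n) * s) (exp y * s) := h.mul_right s
  refine h1.unique ?_
  rw [← hasSum_nat_add_iff' 1]
  simp only [Finset.range_one, Finset.sum_singleton, pow_zero, mul_smul_comm, smul_mul_assoc,
    mul_one, one_mul, sub_self, sub_zero]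
  refine h2.congr_fun ?_
  intro n
  rw [← smul_sub, hpow, smul_smul, smul_mul_assoc, Nat.factorial_succ]
  congr 1
  have : ((n + 1 : ℕ) : ℂ) ≠ 0 := Nat.cast_ne_zero.2 n.succ_ne_zero
  have : (n.factorial : ℂ) ≠ 0 := Nat.cast_ne_zero.2 n.factorial_ne_zero
  push_cast at *
  field_simp

end Exponential

/-! ### Extension of continuous homomorphisms to completions -/

section CompletionLift

/-- The continuous linear extension to the completion of a map into a complete Hausdorff space. -/
def ContinuousLinearMap.completionLift {E F : Type*} [AddCommGroup E] [Module ℂ E]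
    [UniformSpace E] [IsUniformAddGroup E] [UniformContinuousConstSMul ℂ E] [AddCommGroup F]
    [Module ℂ F] [UniformSpace F] [IsUniformAddGroup F] [CompleteSpace F] [T2Space F]
    [ContinuousConstSMul ℂ F] (f : E →L[ℂ] F) : Completion E →L[ℂ] F where
  toFun := Completion.extension f
  map_add' x y := by
    refine Completion.induction_on₂ x y (isClosed_eq ?_ ?_) fun a b => ?_
    · exact Completion.continuous_extension.comp continuous_add
    · exact (Completion.continuous_extension.comp continuous_fst).add
        (Completion.continuous_extension.comp continuous_snd)
    · rw [← Completion.coe_add]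
      simp only [Completion.extension_coe f.uniformContinuous, map_add]
  map_smul' c x := by
    refine Completion.induction_on x (isClosed_eq ?_ ?_) fun a => ?_
    · exact Completion.continuous_extension.comp (continuous_const_smul c)
    · exact Completion.continuous_extension.const_smul _
    · rw [← Completion.coe_smul]
      simp only [Completion.extension_coe f.uniformContinuous, map_smul, RingHom.id_apply]
  cont := Completion.continuous_extension

theorem ContinuousLinearMap.completionLift_coe {E F : Type*} [AddCommGroup E] [Module ℂ E]
    [UniformSpace E] [IsUniformAddGroup E] [UniformContinuousConstSMul ℂ E] [AddCommGroup F]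
    [Module ℂ F] [UniformSpace F] [IsUniformAddGroup F] [CompleteSpace F] [T2Space F]
    [ContinuousConstSMul ℂ F] (f : E →L[ℂ] F) (a : E) :
    f.completionLift (a : Completion E) = f a :=
  Completion.extension_coe f.uniformContinuous a

variable {A B : Type*} [Ring A] [Algebra ℂ A] [UniformSpace A] [IsUniformAddGroup A]
  [IsTopologicalRing A] [UniformContinuousConstSMul ℂ A] [Ring B] [Algebra ℂ B] [UniformSpace B]
  [IsUniformAddGroup B] [IsTopologicalRing B] [CompleteSpace B] [T2Space B]

/-- The extension to the completion of a continuous homomorphism into a complete Hausdorff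
algebra. -/
def ContinuousAlgHom.completionLift (f : A →A[ℂ] B) : Completion A →A[ℂ] B :=
  { AlgHom.ofLinearMap (ContinuousLinearMap.completionLift f.toContinuousLinearMap).toLinearMap
      (by
        change ContinuousLinearMap.completionLift f.toContinuousLinearMap 1 = 1
        rw [← Completion.coe_one, ContinuousLinearMap.completionLift_coe]
        exact map_one f)
      (fun x y => by
        change ContinuousLinearMap.completionLift f.toContinuousLinearMap (x * y) =
          ContinuousLinearMap.completionLift f.toContinuousLinearMap x *
          ContinuousLinearMap.completionLift f.toContinuousLinearMap y
        refine Completion.induction_on₂ x y (isClosed_eq (by fun_prop) (by fun_prop)) fun a b => ?_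
        rw [← Completion.coe_mul]
        simp only [ContinuousLinearMap.completionLift_coe]
        exact map_mul f a b) with
    cont := (ContinuousLinearMap.completionLift f.toContinuousLinearMap).continuous }

theorem ContinuousAlgHom.completionLift_coe (f : A →A[ℂ] B) (a : A) :
    f.completionLift (a : Completion A) = f a :=
  ContinuousLinearMap.completionLift_coe f.toContinuousLinearMap a

end CompletionLift

/-! ### The complete projective tensor product of algebras -/

section PTensorLinear

variable {V W E : Type*} [AddCommGroup V] [Module ℂ V] [TopologicalSpace V]
  [AddCommGroup W] [Module ℂ W] [TopologicalSpace W] [AddCommGroup E] [Module ℂ E]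

theorem ptmul_add_left (v v' : V) (w : W) : ptmul (v + v') w = ptmul v w + ptmul v' w := by
  simp only [ptmul, TensorProduct.add_tmul, Completion.coe_add]

theorem ptmul_add_right (v : V) (w w' : W) : ptmul v (w + w') = ptmul v w + ptmul v w' := by
  simp only [ptmul, TensorProduct.tmul_add, Completion.coe_add]

theorem ptmul_smul_left (c : ℂ) (v : V) (w : W) : ptmul (c • v) w = c • ptmul v w := by
  rw [ptmul, ← TensorProduct.smul_tmul', Completion.coe_smul, ptmul]

theorem ptmul_smul_right (c : ℂ) (v : V) (w : W) : ptmul v (c • w) = c • ptmul v w := by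
  rw [ptmul, TensorProduct.tmul_smul, Completion.coe_smul, ptmul]

theorem ptmul_zero_left (w : W) : ptmul (0 : V) w = 0 := by
  rw [ptmul, TensorProduct.zero_tmul, Completion.coe_zero]

theorem ptmul_zero_right (v : V) : ptmul v (0 : W) = 0 := by
  rw [ptmul, TensorProduct.tmul_zero, Completion.coe_zero]

/-- A closed additive property that holds for elementary tensors holds on the complete projective
tensor product. -/
@[elab_as_elim]
theorem PTensor.induction_on {P : PTensor V W → Prop} (u : PTensor V W) (hc : IsClosed {u | P u})
    (h0 : P 0) (ht : ∀ v w, P (ptmul v w)) (ha : ∀ u u', P u → P u' → P (u + u')) : P u := by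
  refine Completion.induction_on u hc fun t => ?_
  induction t using TensorProduct.induction_on with
  | zero => rwa [Completion.coe_zero]
  | tmul v w => exact ht v w
  | add x y hx hy => rw [Completion.coe_add]; exact ha _ _ hx hy

theorem PTensor.clm_apply_eq [TopologicalSpace E] [T2Space E] {f g : PTensor V W →L[ℂ] E}
    (h : ∀ v w, f (ptmul v w) = g (ptmul v w)) (u : PTensor V W) : f u = g u :=
  PTensor.induction_on u (isClosed_eq f.continuous g.continuous) (by simp) h
    fun u u' hu hu' => by rw [map_add, map_add, hu, hu']

/-- The universal property of the projective topology. -/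
theorem continuous_of_continuous_tmul [TopologicalSpace E] [PolynormableSpace ℂ E]
    (f : V ⊗[ℂ] W →ₗ[ℂ] E) (h : Continuous fun x : V × W => f (x.1 ⊗ₜ x.2)) : Continuous f := by
  refine WithSeminorms.continuous_of_continuous_comp (PolynormableSpace.withSeminorms ℂ E) f
    fun r => ?_
  exact (projective_withSeminorms (V := V) (W := W)).continuous_seminorm ⟨_, r.2.comp h⟩

/-- The linearization of a continuous bilinear map. -/
def PTensor.lift [UniformSpace E] [IsUniformAddGroup E] [CompleteSpace E] [T2Space E]
    [ContinuousConstSMul ℂ E] [PolynormableSpace ℂ E] (β : V →ₗ[ℂ] W →ₗ[ℂ] E)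
    (hβ : Continuous fun x : V × W => β x.1 x.2) : PTensor V W →L[ℂ] E :=
  ContinuousLinearMap.completionLift
    ⟨TensorProduct.lift β, continuous_of_continuous_tmul _ hβ⟩

theorem PTensor.lift_ptmul [UniformSpace E] [IsUniformAddGroup E] [CompleteSpace E] [T2Space E]
    [ContinuousConstSMul ℂ E] [PolynormableSpace ℂ E] (β : V →ₗ[ℂ] W →ₗ[ℂ] E)
    (hβ : Continuous fun x : V × W => β x.1 x.2) (v : V) (w : W) :
    PTensor.lift β hβ (ptmul v w) = β v w :=
  ContinuousLinearMap.completionLift_coe _ _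

end PTensorLinear

section PTensorAlgebra

instance completion_continuousSMul {A : Type*} [Ring A] [Algebra ℂ A] [UniformSpace A]
    [IsUniformAddGroup A] [IsTopologicalRing A] [ContinuousSMul ℂ A]
    [UniformContinuousConstSMul ℂ A] : ContinuousSMul ℂ (Completion A) :=
  continuousSMul_of_algebraMap _ _ <|
    (Completion.continuous_coe A).comp (continuous_algebraMap ℂ A)

variable {A B : Type*} [Ring A] [Algebra ℂ A] [TopologicalSpace A] [IsTopologicalRing A]
  [ContinuousSMul ℂ A] [Ring B] [Algebra ℂ B] [TopologicalSpace B] [IsTopologicalRing B]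
  [ContinuousSMul ℂ B]

theorem ptmul_mul_ptmul (a a' : A) (b b' : B) :
    ptmul a b * ptmul a' b' = ptmul (a * a') (b * b') := by
  rw [ptmul, ptmul, ← Completion.coe_mul, Algebra.TensorProduct.tmul_mul_tmul, ptmul]

omit [IsTopologicalRing A] [ContinuousSMul ℂ A] [IsTopologicalRing B] [ContinuousSMul ℂ B] in
theorem ptmul_one_one : ptmul (1 : A) (1 : B) = 1 := rfl

omit [TopologicalSpace A] [IsTopologicalRing A] [ContinuousSMul ℂ A] [TopologicalSpace B]
  [IsTopologicalRing B] [ContinuousSMul ℂ B] in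
theorem tensorSeminorm_isSubmultiplicative {p : Seminorm ℂ A} {q : Seminorm ℂ B}
    (hp : p.IsSubmultiplicative) (hq : q.IsSubmultiplicative) :
    (tensorSeminorm p q).IsSubmultiplicative := by
  intro u v
  rw [mul_comm (tensorSeminorm p q u)]
  refine le_tensorSeminorm (r := (tensorSeminorm p q).comp (LinearMap.mulRight ℂ v))
    (apply_nonneg _ _) (fun a b => ?_) u
  change tensorSeminorm p q (a ⊗ₜ[ℂ] b * v) ≤ _
  rw [mul_comm (tensorSeminorm p q v)]
  refine le_tensorSeminorm (r := (tensorSeminorm p q).comp (LinearMap.mulLeft ℂ (a ⊗ₜ[ℂ] b)))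
    (mul_nonneg (apply_nonneg _ _) (apply_nonneg _ _)) (fun a' b' => ?_) v
  change tensorSeminorm p q (a ⊗ₜ[ℂ] b * a' ⊗ₜ[ℂ] b') ≤ _
  rw [Algebra.TensorProduct.tmul_mul_tmul]
  calc tensorSeminorm p q ((a * a') ⊗ₜ[ℂ] (b * b')) ≤ p (a * a') * q (b * b') :=
        tensorSeminorm_tmul_le _ _ _ _
    _ ≤ (p a * p a') * (q b * q b') :=
      mul_le_mul (hp a a') (hq b b') (apply_nonneg _ _)
        (mul_nonneg (apply_nonneg _ _) (apply_nonneg _ _))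
    _ = _ := by ring

theorem IsLocallyMConvex.tensorProduct (hA : IsLocallyMConvex A) (hB : IsLocallyMConvex B) :
    IsLocallyMConvex (A ⊗[ℂ] B) := by
  refine .of_withSeminorms (projective_withSeminorms (V := A) (W := B)) fun r => ?_
  have hr : Continuous fun x : A × B => r.1 (TensorProduct.mk ℂ A B x.1 x.2) := r.2
  obtain ⟨p, q, hp, hq, hpq⟩ := exists_seminorm_mul_bound (TensorProduct.mk ℂ A B) r.1 hr
  obtain ⟨p', hp', hpm, c, hc, hpc⟩ := hA.exists_le p hp
  obtain ⟨q', hq', hqm, d, hd, hqd⟩ := hB.exists_le q hq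
  refine ⟨_, continuous_tensorSeminorm hp' hq', tensorSeminorm_isSubmultiplicative hpm hqm,
    c * d, mul_nonneg hc hd, le_tensorSeminorm (mul_nonneg hc hd) fun a b => ?_⟩
  calc r.1 (a ⊗ₜ[ℂ] b) ≤ p a * q b := hpq a b
    _ ≤ (c * p' a) * (d * q' b) := mul_le_mul (hpc a) (hqd b) (apply_nonneg _ _)
        (mul_nonneg hc (apply_nonneg _ _))
    _ = _ := by ring

theorem IsLocallyMConvex.isArensMichael_pTensor (hA : IsLocallyMConvex A)
    (hB : IsLocallyMConvex B) : IsArensMichael (PTensor A B) :=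
  .of_completion (hA.tensorProduct hB)

variable (A B) in
/-- The homomorphism `a ↦ a ⊗ 1`. -/
def PTensor.includeLeft : A →A[ℂ] PTensor A B where
  toFun a := ptmul a 1
  map_one' := rfl
  map_mul' a b := by rw [ptmul_mul_ptmul, mul_one]
  map_zero' := ptmul_zero_left _
  map_add' a b := ptmul_add_left _ _ _
  commutes' c := by
    rw [Algebra.algebraMap_eq_smul_one, Algebra.algebraMap_eq_smul_one, ptmul_smul_left,
      ptmul_one_one]
  cont := by
    refine (Completion.continuous_coe _).comp ?_
    refine WithSeminorms.continuous_of_continuous_comp (projective_withSeminorms (V := A) (W := B))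
      ((TensorProduct.mk ℂ A B).flip 1) fun r => ?_
    have hr : Continuous fun x : A × B => r.1 (x.1 ⊗ₜ[ℂ] x.2) := r.2
    exact hr.comp (continuous_id.prodMk continuous_const)

variable (A B) in
/-- The homomorphism `b ↦ 1 ⊗ b`. -/
def PTensor.includeRight : B →A[ℂ] PTensor A B where
  toFun b := ptmul 1 b
  map_one' := rfl
  map_mul' a b := by rw [ptmul_mul_ptmul, mul_one]
  map_zero' := ptmul_zero_right _
  map_add' a b := ptmul_add_right _ _ _
  commutes' c := by
    rw [Algebra.algebraMap_eq_smul_one, Algebra.algebraMap_eq_smul_one, ptmul_smul_right,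
      ptmul_one_one]
  cont := by
    refine (Completion.continuous_coe _).comp ?_
    refine WithSeminorms.continuous_of_continuous_comp (projective_withSeminorms (V := A) (W := B))
      (TensorProduct.mk ℂ A B 1) fun r => ?_
    have hr : Continuous fun x : A × B => r.1 (x.1 ⊗ₜ[ℂ] x.2) := r.2
    exact hr.comp (continuous_const.prodMk continuous_id)

theorem PTensor.includeLeft_apply (a : A) : PTensor.includeLeft A B a = ptmul a 1 := rfl

theorem PTensor.includeRight_apply (b : B) : PTensor.includeRight A B b = ptmul 1 b := rfl

variable {C : Type*} [UniformSpace C] [Ring C] [Algebra ℂ C] [IsUniformAddGroup C]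
  [IsTopologicalRing C]

/-- Two continuous homomorphisms with commuting ranges, into an Arens-Michael algebra, define a
continuous homomorphism `a ⊗ b ↦ f a * g b`. -/
def PTensor.algLift (hC : IsArensMichael C) (f : A →A[ℂ] C) (g : B →A[ℂ] C)
    (h : ∀ a b, Commute (f a) (g b)) : PTensor A B →A[ℂ] C :=
  have := hC.t2
  have := hC.complete
  have : PolynormableSpace ℂ C := hC.withSeminorms.toPolynormableSpace
  ContinuousAlgHom.completionLift
    { Algebra.TensorProduct.lift (f : A →ₐ[ℂ] C) (g : B →ₐ[ℂ] C) h with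
      cont := by
        refine continuous_of_continuous_tmul
          (Algebra.TensorProduct.lift (f : A →ₐ[ℂ] C) (g : B →ₐ[ℂ] C) h).toLinearMap ?_
        have : Continuous fun x : A × B => f x.1 * g x.2 :=
          (f.continuous.comp continuous_fst).mul (g.continuous.comp continuous_snd)
        simpa using this }

theorem PTensor.algLift_ptmul (hC : IsArensMichael C) (f : A →A[ℂ] C) (g : B →A[ℂ] C)
    (h : ∀ a b, Commute (f a) (g b)) (a : A) (b : B) :
    PTensor.algLift hC f g h (ptmul a b) = f a * g b := by
  have := hC.t2
  have := hC.complete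
  refine (ContinuousAlgHom.completionLift_coe _ _).trans ?_
  exact Algebra.TensorProduct.lift_tmul (f : A →ₐ[ℂ] C) (g : B →ₐ[ℂ] C) h a b

/-- The tensor product of two continuous homomorphisms of algebras is again a homomorphism. -/
theorem PTensor.exists_algHom_eq_map {A' B' : Type*} [Ring A'] [Algebra ℂ A'] [TopologicalSpace A']
    [IsTopologicalRing A'] [ContinuousSMul ℂ A'] [Ring B'] [Algebra ℂ B'] [TopologicalSpace B']
    [IsTopologicalRing B'] [ContinuousSMul ℂ B'] (f : A →A[ℂ] A') (g : B →A[ℂ] B')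
    (hC : IsArensMichael (PTensor A' B')) :
    ∃ φ : PTensor A B →A[ℂ] PTensor A' B',
      ∀ u, φ u = PTensor.map f.toContinuousLinearMap g.toContinuousLinearMap u := by
  refine ⟨PTensor.algLift hC ((PTensor.includeLeft A' B').comp f)
    ((PTensor.includeRight A' B').comp g) fun a b => ?_, fun u => ?_⟩
  · simp [Commute, SemiconjBy, PTensor.includeLeft_apply, PTensor.includeRight_apply,
      ptmul_mul_ptmul]
  · refine PTensor.clm_apply_eq (f := (PTensor.algLift hC _ _ _).toContinuousLinearMap)
      (fun a b => ?_) u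
    rw [PTensor.map_ptmul]
    refine (PTensor.algLift_ptmul hC _ _ _ a b).trans ?_
    simp [PTensor.includeLeft_apply, PTensor.includeRight_apply, ptmul_mul_ptmul]

end PTensorAlgebra

/-! ### Power series expansions of free entire functions -/

section FreeEntireSeries

variable {n : ℕ}

theorem basisFreeMonoid_apply (w : FreeMonoid (Fin n)) :
    FreeAlgebra.basisFreeMonoid ℂ (Fin n) w = FreeMonoid.lift (FreeAlgebra.ι ℂ) w := by
  simp [FreeAlgebra.basisFreeMonoid, FreeAlgebra.equivMonoidAlgebraFreeMonoid]

theorem sum_repr_smul_word (a : FreeAlgebra ℂ (Fin n)) {s : Finset (FreeMonoid (Fin n))}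
    (hs : ((FreeAlgebra.basisFreeMonoid ℂ (Fin n)).repr a).support ⊆ s) :
    ∑ w ∈ s, (FreeAlgebra.basisFreeMonoid ℂ (Fin n)).repr a w • FreeMonoid.lift (FreeAlgebra.ι ℂ) w
      = a := by
  conv_rhs => rw [← (FreeAlgebra.basisFreeMonoid ℂ (Fin n)).linearCombination_repr a]
  rw [Finsupp.linearCombination_apply, Finsupp.sum_of_support_subset _ hs _ (by simp)]
  simp only [basisFreeMonoid_apply]

/-- The weighted `ℓ¹`-seminorm `∑_w |c_w| ρ ^ |w|` on the free algebra. -/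
def wordSeminorm (n : ℕ) (ρ : ℝ) (hρ : 0 ≤ ρ) : Seminorm ℂ (FreeAlgebra ℂ (Fin n)) :=
  Seminorm.of
    (fun a => ((FreeAlgebra.basisFreeMonoid ℂ (Fin n)).repr a).sum fun w c => ‖c‖ * ρ ^ w.length)
    (fun a b => by
      classical
      set f := (FreeAlgebra.basisFreeMonoid ℂ (Fin n)).repr a with hf
      set g := (FreeAlgebra.basisFreeMonoid ℂ (Fin n)).repr b with hg
      rw [map_add, ← hf, ← hg,
        Finsupp.sum_of_support_subset (f + g) Finsupp.support_add _ (by simp),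
        Finsupp.sum_of_support_subset f Finset.subset_union_left _ (by simp),
        Finsupp.sum_of_support_subset g Finset.subset_union_right _ (by simp),
        ← Finset.sum_add_distrib]
      refine Finset.sum_le_sum fun w _ => ?_
      rw [← add_mul]
      exact mul_le_mul_of_nonneg_right (norm_add_le _ _) (by positivity))
    (fun c a => by
      rw [map_smul, Finsupp.sum_of_support_subset _ Finsupp.support_smul _ (by simp), Finsupp.sum,
        Finset.mul_sum]
      exact Finset.sum_congr rfl fun w _ => by simp [mul_assoc])

theorem wordSeminorm_apply {ρ : ℝ} (hρ : 0 ≤ ρ) (a : FreeAlgebra ℂ (Fin n)) :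
    wordSeminorm n ρ hρ a =
      ((FreeAlgebra.basisFreeMonoid ℂ (Fin n)).repr a).sum fun w c => ‖c‖ * ρ ^ w.length := rfl

theorem wordSeminorm_eq_sum {ρ : ℝ} (hρ : 0 ≤ ρ) (a : FreeAlgebra ℂ (Fin n))
    {s : Finset (FreeMonoid (Fin n))}
    (hs : ((FreeAlgebra.basisFreeMonoid ℂ (Fin n)).repr a).support ⊆ s) :
    wordSeminorm n ρ hρ a =
      ∑ w ∈ s, ‖(FreeAlgebra.basisFreeMonoid ℂ (Fin n)).repr a w‖ * ρ ^ w.length := by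
  rw [wordSeminorm_apply, Finsupp.sum_of_support_subset _ hs _ (by simp)]

theorem sum_le_wordSeminorm {ρ : ℝ} (hρ : 0 ≤ ρ) (a : FreeAlgebra ℂ (Fin n))
    (s : Finset (FreeMonoid (Fin n))) :
    ∑ w ∈ s, ‖(FreeAlgebra.basisFreeMonoid ℂ (Fin n)).repr a w‖ * ρ ^ w.length ≤
      wordSeminorm n ρ hρ a := by
  classical
  rw [wordSeminorm_eq_sum hρ a (Finset.subset_union_right (s₁ := s))]
  exact Finset.sum_le_sum_of_subset_of_nonneg Finset.subset_union_left
    fun _ _ _ => by positivity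

theorem wordSeminorm_word {ρ : ℝ} (hρ : 0 ≤ ρ) (w : FreeMonoid (Fin n)) :
    wordSeminorm n ρ hρ (FreeMonoid.lift (FreeAlgebra.ι ℂ) w) = ρ ^ w.length := by
  rw [wordSeminorm_apply, ← basisFreeMonoid_apply, Module.Basis.repr_self,
    Finsupp.sum_single_index] <;> simp

/-- The weighted `ℓ¹`-seminorm is the largest seminorm with given values on words. -/
theorem le_wordSeminorm {ρ C : ℝ} (hρ : 0 ≤ ρ) (q : Seminorm ℂ (FreeAlgebra ℂ (Fin n)))
    (hq : ∀ w, q (FreeMonoid.lift (FreeAlgebra.ι ℂ) w) ≤ C * ρ ^ w.length)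
    (a : FreeAlgebra ℂ (Fin n)) : q a ≤ C * wordSeminorm n ρ hρ a := by
  conv_lhs => rw [← sum_repr_smul_word a subset_rfl]
  rw [wordSeminorm_eq_sum hρ a subset_rfl, Finset.mul_sum]
  refine (Finset.le_sum_of_subadditive _ (map_zero _).le (map_add_le_add _) _ _).trans
    (Finset.sum_le_sum fun w _ => ?_)
  rw [map_smul_eq_mul, mul_left_comm]
  exact mul_le_mul_of_nonneg_left (hq w) (norm_nonneg _)

theorem wordSeminorm_isSubmultiplicative {ρ : ℝ} (hρ : 0 ≤ ρ) :
    (wordSeminorm n ρ hρ).IsSubmultiplicative := by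
  intro a b
  refine le_wordSeminorm hρ ((wordSeminorm n ρ hρ).comp (LinearMap.mulLeft ℂ a)) (fun v => ?_) b
  change wordSeminorm n ρ hρ (a * _) ≤ _
  rw [mul_comm (wordSeminorm n ρ hρ a)]
  refine le_wordSeminorm hρ ((wordSeminorm n ρ hρ).comp
    (LinearMap.mulRight ℂ (FreeMonoid.lift (FreeAlgebra.ι ℂ) v))) (fun w => ?_) a
  change wordSeminorm n ρ hρ (_ * _) ≤ _
  rw [← map_mul, wordSeminorm_word, FreeMonoid.length_mul, pow_add, mul_comm]

/-- A submultiplicative seminorm is at most `p 1 * ρ ^ |w|` on a word `w`, if it is at most `ρ` on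
the generators. -/
theorem Seminorm.IsSubmultiplicative.le_wordSeminorm {p : Seminorm ℂ (FreeAlgebra ℂ (Fin n))}
    (hp : p.IsSubmultiplicative) {ρ : ℝ} (hρ : 0 ≤ ρ) (h : ∀ i, p (FreeAlgebra.ι ℂ i) ≤ ρ)
    (a : FreeAlgebra ℂ (Fin n)) : p a ≤ p 1 * wordSeminorm n ρ hρ a := by
  refine _root_.le_wordSeminorm hρ p (fun w => ?_) a
  induction w using FreeMonoid.inductionOn' with
  | one => simp
  | of_mul x w ih =>
    rw [map_mul, FreeMonoid.lift_eval_of, FreeMonoid.length_mul, FreeMonoid.length_of, pow_add,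
      pow_one, mul_left_comm]
    exact (hp _ _).trans (mul_le_mul (h x) ih (apply_nonneg _ _) hρ)

/-- Countably many weighted `ℓ¹`-seminorms determine the topology of the free algebra. -/
theorem wordSeminorm_withSeminorms (n : ℕ) :
    WithSeminorms (fun k : ℕ => wordSeminorm n k k.cast_nonneg) := by
  refine (freeAlgebra_withSeminorms n).congr (fun k => ?_) fun p => ?_
  · refine ⟨{⟨_, wordSeminorm_isSubmultiplicative k.cast_nonneg⟩}, 1, fun a => ?_⟩
    rw [Finset.sup_singleton, one_smul]
    rfl
  · obtain ⟨k, hk⟩ := exists_nat_ge (∑ i, p.1 (FreeAlgebra.ι ℂ i))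
    refine ⟨{k}, ⟨p.1 1, apply_nonneg _ _⟩, fun a => ?_⟩
    rw [Finset.sup_singleton]
    refine Seminorm.IsSubmultiplicative.le_wordSeminorm p.2 k.cast_nonneg (fun i => ?_) a
    exact (Finset.single_le_sum (f := fun i => p.1 (FreeAlgebra.ι ℂ i))
      (fun _ _ => apply_nonneg _ _) (Finset.mem_univ i)).trans hk

theorem isLocallyMConvex_freeAlgebra (n : ℕ) : IsLocallyMConvex (FreeAlgebra ℂ (Fin n)) :=
  .of_withSeminorms (freeAlgebra_withSeminorms n) fun p =>
    ⟨p.1, (freeAlgebra_withSeminorms n).continuous_seminorm p, p.2, 1, zero_le_one,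
      fun _ => (one_mul _).ge⟩

theorem isArensMichael_freeEntire (n : ℕ) : IsArensMichael (FreeEntire n) :=
  .of_completion (isLocallyMConvex_freeAlgebra n)

instance freeEntire_firstCountableTopology : FirstCountableTopology (FreeEntire n) :=
  (wordSeminorm_withSeminorms n).completion.firstCountableTopology

/-- The coefficient of a word in a free entire function. -/
def FreeEntire.coeff (w : FreeMonoid (Fin n)) : FreeEntire n →L[ℂ] ℂ :=
  ContinuousLinearMap.completionLift
    ⟨(FreeAlgebra.basisFreeMonoid ℂ (Fin n)).coord w, by
      refine WithSeminorms.continuous_of_continuous_comp (norm_withSeminorms ℂ ℂ) _ fun _ => ?_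
      refine Seminorm.continuous_of_le
        ((wordSeminorm_withSeminorms n).continuous_seminorm 1) fun a => ?_
      simpa using sum_le_wordSeminorm (Nat.cast_nonneg 1) a {w}⟩

theorem FreeEntire.coeff_coe (w : FreeMonoid (Fin n)) (a : FreeAlgebra ℂ (Fin n)) :
    FreeEntire.coeff w (a : FreeEntire n) = (FreeAlgebra.basisFreeMonoid ℂ (Fin n)).repr a w :=
  ContinuousLinearMap.completionLift_coe _ _

theorem FreeEntire.lift_ζ (w : FreeMonoid (Fin n)) :
    FreeMonoid.lift (FreeEntire.ζ : Fin n → FreeEntire n) w =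
      ((FreeMonoid.lift (FreeAlgebra.ι ℂ) w : FreeAlgebra ℂ (Fin n)) : FreeEntire n) :=
  (FreeMonoid.hom_map_lift (Completion.coeRingHom (α := FreeAlgebra ℂ (Fin n))).toMonoidHom
    (FreeAlgebra.ι ℂ) w).symm

theorem FreeEntire.sum_coeff_le (k : ℕ) (x : FreeEntire n) (s : Finset (FreeMonoid (Fin n))) :
    ∑ w ∈ s, ‖FreeEntire.coeff w x‖ * (k : ℝ) ^ w.length ≤
      (wordSeminorm n k k.cast_nonneg).completion
        ((wordSeminorm_withSeminorms n).continuous_seminorm k) x := by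
  refine Completion.induction_on x (isClosed_le (by fun_prop)
    (Seminorm.continuous_completion _ _)) fun a => ?_
  rw [Seminorm.completion_coe]
  simp only [FreeEntire.coeff_coe]
  exact sum_le_wordSeminorm _ a s

theorem FreeEntire.summable_coeff (x : FreeEntire n) {ρ : ℝ} (hρ : 0 < ρ) :
    Summable fun w : FreeMonoid (Fin n) => ‖FreeEntire.coeff w x‖ * ρ ^ w.length := by
  obtain ⟨k, hk⟩ := exists_nat_ge ρ
  refine Summable.of_nonneg_of_le (fun w => by positivity) (fun w => ?_)
    (summable_of_sum_le (fun w => by positivity) (FreeEntire.sum_coeff_le k x))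
  gcongr

/-- Every free entire function is the sum of its power series: this is clear for polynomials `a`,
and the partial sums are contractions for each weighted `ℓ¹`-seminorm. -/
theorem FreeEntire.hasSum_coeff (x : FreeEntire n) :
    HasSum (fun w => FreeEntire.coeff w x • FreeMonoid.lift (FreeEntire.ζ : Fin n → FreeEntire n) w)
      x := by
  classical
  rw [HasSum, SummationFilter.unconditional_filter,
    (wordSeminorm_withSeminorms n).completion.tendsto_nhds]
  intro k ε hε
  have hc := (wordSeminorm n k k.cast_nonneg).continuous_completion
    ((wordSeminorm_withSeminorms n).continuous_seminorm k)
  set N := (wordSeminorm n k k.cast_nonneg).completion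
    ((wordSeminorm_withSeminorms n).continuous_seminorm k) with hN
  obtain ⟨a, ha⟩ : ∃ a : FreeAlgebra ℂ (Fin n), N (x - a) < ε / 2 := by
    have hopen : IsOpen {y | N (x - y) < ε / 2} :=
      isOpen_lt (hc.comp (continuous_const.sub continuous_id)) continuous_const
    obtain ⟨_, hy, a, rfl⟩ :=
      (Completion.denseRange_coe (α := FreeAlgebra ℂ (Fin n))).inter_open_nonempty _ hopen
        ⟨x, by simpa using half_pos hε⟩
    exact ⟨a, hy⟩
  -- A partial sum over a set of words containing those of `a` reproduces `a`.
  filter_upwards [Filter.eventually_ge_atTop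
    ((FreeAlgebra.basisFreeMonoid ℂ (Fin n)).repr a).support] with s hs
  have hsa : ∑ w ∈ s, FreeEntire.coeff w (a : FreeEntire n) •
      FreeMonoid.lift (FreeEntire.ζ : Fin n → FreeEntire n) w = a := by
    simp only [FreeEntire.coeff_coe, FreeEntire.lift_ζ, ← Completion.coe_smul]
    exact (map_sum (Completion.coeRingHom (α := FreeAlgebra ℂ (Fin n))) _ s).symm.trans
      (congrArg _ (sum_repr_smul_word a hs))
  have e : ∑ w ∈ s, FreeEntire.coeff w x • FreeMonoid.lift (FreeEntire.ζ : Fin n → FreeEntire n) w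
      - x = ∑ w ∈ s, FreeEntire.coeff w (x - a) •
        FreeMonoid.lift (FreeEntire.ζ : Fin n → FreeEntire n) w - (x - a) := by
    simp only [map_sub, sub_smul, Finset.sum_sub_distrib, hsa]
    abel
  change N _ < ε
  rw [e]
  have h1 : N (∑ w ∈ s, FreeEntire.coeff w (x - a) •
      FreeMonoid.lift (FreeEntire.ζ : Fin n → FreeEntire n) w) ≤ N (x - a) := by
    refine (Finset.le_sum_of_subadditive _ (map_zero _).le (map_add_le_add _) _ _).trans
      (le_trans (Finset.sum_le_sum fun w _ => ?_)
        (FreeEntire.sum_coeff_le k (x - (a : FreeEntire n)) s))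
    rw [map_smul_eq_mul, FreeEntire.lift_ζ, hN, Seminorm.completion_coe, wordSeminorm_word]
  have h2 := map_sub_le_add N (∑ w ∈ s, FreeEntire.coeff w (x - a) •
      FreeMonoid.lift (FreeEntire.ζ : Fin n → FreeEntire n) w) (x - (a : FreeEntire n))
  linarith

/-- The universal property of the algebra of free entire functions. -/
theorem FreeEntire.exists_lift {B : Type*} [Ring B] [Algebra ℂ B] [UniformSpace B]
    [IsUniformAddGroup B] [IsTopologicalRing B] (hB : IsArensMichael B) (b : Fin n → B) :
    ∃ φ : FreeEntire n →A[ℂ] B, ∀ i, φ (FreeEntire.ζ i) = b i := by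
  have := hB.t2
  have := hB.complete
  let f : FreeAlgebra ℂ (Fin n) →A[ℂ] B :=
    { FreeAlgebra.lift ℂ b with
      cont := IsLocallyMConvex.continuous_of_comp hB.withSeminorms
        (FreeAlgebra.lift ℂ b).toLinearMap fun p _ hp =>
          (freeAlgebra_withSeminorms n).continuous_seminorm
            ⟨p.comp (FreeAlgebra.lift ℂ b).toLinearMap, fun x y => by
              simpa using hp (FreeAlgebra.lift ℂ b x) (FreeAlgebra.lift ℂ b y)⟩ }
  exact ⟨f.completionLift, fun i => (f.completionLift_coe _).trans (FreeAlgebra.lift_ι_apply b i)⟩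

end FreeEntireSeries

/-! ### The deformed algebra and its universal property -/

theorem isClosed_closedTwoSidedSpan {R : Type*} [Ring R] [TopologicalSpace R] (s : Set R) :
    IsClosed (closedTwoSidedSpan s : Set R) := by
  rw [closedTwoSidedSpan, Submodule.coe_sInf]
  exact isClosed_biInter fun J hJ => hJ.2.1

theorem subset_closedTwoSidedSpan {R : Type*} [Ring R] [TopologicalSpace R] (s : Set R) :
    s ⊆ closedTwoSidedSpan s := by
  intro x hx
  rw [SetLike.mem_coe, closedTwoSidedSpan, Submodule.mem_sInf]
  exact fun J hJ => hJ.2.2 hx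

namespace UAf

variable {ħ : ℂ}

theorem mk_eq_zero_iff {x : FreeEntire 2} : mk ħ x = 0 ↔ x ∈ afIdeal ħ :=
  Ideal.Quotient.eq_zero_iff_mem

variable (ħ) in
/-- The quotient homomorphism, as a continuous homomorphism. -/
def mkA : FreeEntire 2 →A[ℂ] UAf ħ :=
  { mk ħ with cont := (isOpenQuotientMap_mk ħ).continuous }

variable (ħ) in
/-- Completeness of the quotient uses that `FreeEntire 2` is first countable. -/
theorem isArensMichael : IsArensMichael (UAf ħ) where
  t2 := by
    have : IsClosed ((afIdeal ħ).toAddSubgroup : Set (FreeEntire 2)) :=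
      isClosed_closedTwoSidedSpan _
    exact inferInstanceAs (T2Space (FreeEntire 2 ⧸ (afIdeal ħ).toAddSubgroup))
  complete := QuotientAddGroup.completeSpace_right (FreeEntire 2) (afIdeal ħ).toAddSubgroup
  withSeminorms := IsLocallyMConvex.of_isOpenQuotientMap
    (isArensMichael_freeEntire 2).withSeminorms (mk ħ) (isOpenQuotientMap_mk ħ)

instance : T2Space (UAf ħ) := (isArensMichael ħ).t2

instance : CompleteSpace (UAf ħ) := (isArensMichael ħ).complete

instance : PolynormableSpace ℂ (UAf ħ) := (isArensMichael ħ).withSeminorms.toPolynormableSpace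

variable (ħ) in
theorem metrizableSpace : TopologicalSpace.MetrizableSpace (UAf ħ) := by
  have h : 𝓝 (0 : UAf ħ) = Filter.map (mk ħ) (𝓝 0) := by
    rw [(isOpenQuotientMap_mk ħ).map_nhds_eq, map_zero]
  have : (𝓝 (0 : UAf ħ)).IsCountablyGenerated := by rw [h]; infer_instance
  have : (uniformity (UAf ħ)).IsCountablyGenerated :=
    IsUniformAddGroup.uniformity_countably_generated
  exact UniformSpace.metrizableSpace

variable (ħ) in
theorem isHolomorphicallyGenerated : IsHolomorphicallyGenerated ![X ħ, Y ħ] := by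
  intro a
  obtain ⟨x, rfl⟩ := (isOpenQuotientMap_mk ħ).surjective a
  refine ⟨fun w => FreeEntire.coeff w x, fun ρ hρ => FreeEntire.summable_coeff x hρ, ?_⟩
  change HasSum _ (mkA ħ x)
  convert (FreeEntire.hasSum_coeff x).map (mkA ħ) (mkA ħ).continuous using 2 with w
  have hXY : ![X ħ, Y ħ] = mkA ħ ∘ FreeEntire.ζ := by
    ext i; fin_cases i <;> rfl
  rw [hXY, Function.comp_apply, map_smul]
  congr 1
  exact (FreeMonoid.hom_map_lift ((mkA ħ : FreeEntire 2 →ₐ[ℂ] UAf ħ) : FreeEntire 2 →* UAf ħ)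
    FreeEntire.ζ w).symm

variable (ħ) in
theorem isHFG : IsHFG (UAf ħ) :=
  ⟨isArensMichael ħ, metrizableSpace ħ, 2, _, isHolomorphicallyGenerated ħ⟩

variable (ħ) in
theorem afRelation : AfRelation ħ (X ħ) (Y ħ) := by
  have h := mk_eq_zero_iff.2 (subset_closedTwoSidedSpan _ (Set.mem_singleton
    (FreeEntire.ζ 0 * FreeEntire.ζ 1 - FreeEntire.ζ 1 * FreeEntire.ζ 0
      - (Complex.sinh ħ)⁻¹ • algSinh (ħ • (FreeEntire.ζ 1 : FreeEntire 2)))) :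
      _ ∈ afIdeal ħ)
  rw [map_sub, sub_eq_zero, map_sub, map_mul, map_mul, map_smul] at h
  have h2 : mk ħ (algSinh (ħ • (FreeEntire.ζ 1 : FreeEntire 2))) = algSinh (ħ • Y ħ) := by
    refine ((isArensMichael_freeEntire 2).map_algSinh (mkA ħ) _).trans ?_
    rw [map_smul]; rfl
  rw [h2] at h
  exact h

/-- A closed subalgebra containing the generators is everything. -/
theorem subalgebra_eq_top (S : Subalgebra ℂ (UAf ħ)) (hS : IsClosed (S : Set (UAf ħ)))
    (hX : X ħ ∈ S) (hY : Y ħ ∈ S) (a : UAf ħ) : a ∈ S := by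
  obtain ⟨c, _, hc⟩ := isHolomorphicallyGenerated ħ a
  refine hS.mem_of_tendsto hc (Filter.Eventually.of_forall fun s => ?_)
  refine sum_mem fun w _ => S.smul_mem ?_ _
  rw [FreeMonoid.lift_apply]
  refine list_prod_mem fun x hx => ?_
  obtain ⟨i, _, rfl⟩ := List.mem_map.1 hx
  fin_cases i
  · exact hX
  · exact hY

theorem algHom_ext {B : Type*} [Ring B] [Algebra ℂ B] [TopologicalSpace B] [T2Space B]
    {φ ψ : UAf ħ →A[ℂ] B} (hX : φ (X ħ) = ψ (X ħ)) (hY : φ (Y ħ) = ψ (Y ħ)) : φ = ψ := by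
  ext a
  exact subalgebra_eq_top (AlgHom.equalizer (φ : UAf ħ →ₐ[ℂ] B) (ψ : UAf ħ →ₐ[ℂ] B))
    (isClosed_eq φ.continuous ψ.continuous) hX hY a

/-- The kernel of the homomorphism `FreeEntire 2 → B` with values `x`, `y` on the generators is a
closed two-sided ideal that contains the defining relation. -/
theorem exists_lift {B : Type*} [Ring B] [Algebra ℂ B] [UniformSpace B] [IsUniformAddGroup B]
    [IsTopologicalRing B] (hB : IsArensMichael B) {x y : B} (h : AfRelation ħ x y) :
    ∃ φ : UAf ħ →A[ℂ] B, φ (X ħ) = x ∧ φ (Y ħ) = y := by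
  have := hB.t2
  obtain ⟨φ, hφ⟩ := FreeEntire.exists_lift hB ![x, y]
  have h0 : φ (FreeEntire.ζ 0) = x := hφ 0
  have h1 : φ (FreeEntire.ζ 1) = y := hφ 1
  have hker : afIdeal ħ ≤ RingHom.ker (φ : FreeEntire 2 →ₐ[ℂ] B) := by
    refine sInf_le ⟨inferInstance, ?_, ?_⟩
    · exact isClosed_singleton.preimage φ.continuous
    · rw [Set.singleton_subset_iff, SetLike.mem_coe, RingHom.mem_ker]
      change φ _ = 0
      rw [map_sub, map_sub, map_mul, map_mul, map_smul, (isArensMichael_freeEntire 2).map_algSinh,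
        map_smul, h0, h1, sub_eq_zero]
      exact h
  let ψ : UAf ħ →ₐ[ℂ] B := Ideal.Quotient.liftₐ (afIdeal ħ) (φ : FreeEntire 2 →ₐ[ℂ] B) hker
  have hψ : ∀ a, ψ (mk ħ a) = φ a := fun a => rfl
  refine ⟨{ ψ with cont := ?_ }, (hψ _).trans h0, (hψ _).trans h1⟩
  exact (isOpenQuotientMap_mk ħ).isQuotientMap.continuous_iff.2 φ.continuous

theorem existsUnique_lift {B : Type*} [Ring B] [Algebra ℂ B] [UniformSpace B]
    [IsUniformAddGroup B] [IsTopologicalRing B] (hB : IsArensMichael B) {x y : B}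
    (h : AfRelation ħ x y) : ∃! φ : UAf ħ →A[ℂ] B, φ (X ħ) = x ∧ φ (Y ħ) = y := by
  have := hB.t2
  obtain ⟨φ, hx, hy⟩ := exists_lift hB h
  exact ⟨φ, ⟨hx, hy⟩, fun ψ hψ => algHom_ext (hψ.1.trans hx.symm) (hψ.2.trans hy.symm)⟩

/-- The characters `X ↦ x`, `Y ↦ 0` with `x ∈ ℂ` show that `X` is not algebraic. -/
theorem not_finiteDimensional : ¬ FiniteDimensional ℂ (UAf ħ) := by
  intro _
  obtain ⟨P, hP, hP0⟩ := Algebra.IsAlgebraic.isAlgebraic (R := ℂ) (X ħ)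
  refine hP (Polynomial.funext fun x => ?_)
  obtain ⟨φ, hx, -⟩ := exists_lift (ħ := ħ) isArensMichael_complex (x := x) (y := 0)
    (by simp [AfRelation, algSinh_zero])
  have := congrArg φ hP0
  rw [map_zero] at this
  rw [Polynomial.eval_zero, ← this, ← hx]
  exact (Polynomial.aeval_algHom_apply (φ : UAf ħ →ₐ[ℂ] ℂ) (X ħ) P)

end UAf

/-! ### Structure maps of tensor products of algebras -/

section PTensorStructure

theorem ptmul_sub_left {V W : Type*} [AddCommGroup V] [Module ℂ V] [TopologicalSpace V]
    [AddCommGroup W] [Module ℂ W] [TopologicalSpace W] (v v' : V) (w : W) :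
    ptmul (v - v') w = ptmul v w - ptmul v' w := by
  simp only [ptmul, TensorProduct.sub_tmul, Completion.coe_sub]

theorem ptmul_sub_right {V W : Type*} [AddCommGroup V] [Module ℂ V] [TopologicalSpace V]
    [AddCommGroup W] [Module ℂ W] [TopologicalSpace W] (v : V) (w w' : W) :
    ptmul v (w - w') = ptmul v w - ptmul v w' := by
  simp only [ptmul, TensorProduct.tmul_sub, Completion.coe_sub]

variable {A B C : Type*} [Ring A] [Algebra ℂ A] [TopologicalSpace A] [IsTopologicalRing A]
  [ContinuousSMul ℂ A] [Ring B] [Algebra ℂ B] [TopologicalSpace B] [IsTopologicalRing B]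
  [ContinuousSMul ℂ B] [Ring C] [Algebra ℂ C] [TopologicalSpace C] [IsTopologicalRing C]
  [ContinuousSMul ℂ C]

/-- The associativity homomorphism. -/
theorem PTensor.exists_assoc (hA : IsLocallyMConvex A) (hB : IsLocallyMConvex B)
    (hC : IsLocallyMConvex C) :
    ∃ α : PTensor (PTensor A B) C →A[ℂ] PTensor A (PTensor B C),
      ∀ a b c, α (ptmul (ptmul a b) c) = ptmul a (ptmul b c) := by
  have h : IsArensMichael (PTensor A (PTensor B C)) :=
    hA.isArensMichael_pTensor (hB.isArensMichael_pTensor hC).withSeminorms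
  let f : PTensor A B →A[ℂ] PTensor A (PTensor B C) :=
    PTensor.algLift h (PTensor.includeLeft A (PTensor B C))
      ((PTensor.includeRight A (PTensor B C)).comp (PTensor.includeLeft B C)) fun a b => by
        simp [Commute, SemiconjBy, PTensor.includeLeft_apply, PTensor.includeRight_apply,
          ptmul_mul_ptmul]
  have hf : ∀ a b, f (ptmul a b) = ptmul a (ptmul b 1) := fun a b => by
    refine (PTensor.algLift_ptmul h _ _ _ a b).trans ?_
    simp [PTensor.includeLeft_apply, PTensor.includeRight_apply, ptmul_mul_ptmul]
  let g : C →A[ℂ] PTensor A (PTensor B C) :=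
    (PTensor.includeRight A (PTensor B C)).comp (PTensor.includeRight B C)
  have hg : ∀ c, g c = ptmul 1 (ptmul 1 c) := fun c => rfl
  refine ⟨PTensor.algLift h f g fun u c => ?_, fun a b c => ?_⟩
  · have := h.t2
    induction u using PTensor.induction_on with
    | hc =>
      exact isClosed_eq (f.continuous.mul continuous_const) (continuous_const.mul f.continuous)
    | h0 => rw [map_zero]; exact (zero_mul (g c)).trans (mul_zero (g c)).symm
    | ht a b => simp [Commute, SemiconjBy, hf, hg, ptmul_mul_ptmul]
    | ha u u' hu hu' => rw [commute_iff_eq, map_add, add_mul, mul_add, hu.eq, hu'.eq]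
  · rw [PTensor.algLift_ptmul, hf, hg, ptmul_mul_ptmul, ptmul_mul_ptmul]
    simp

variable {H : Type*} [Ring H] [Algebra ℂ H] [UniformSpace H] [IsUniformAddGroup H]
  [IsTopologicalRing H] [ContinuousSMul ℂ H]

variable (H) in
/-- The unit `ℂ → H`, as a continuous homomorphism. -/
def ContinuousAlgHom.unit : ℂ →A[ℂ] H :=
  ⟨Algebra.ofId ℂ H, continuous_algebraMap ℂ H⟩

/-- The canonical homomorphism `c ⊗ a ↦ c a`. -/
theorem PTensor.exists_lid (hH : IsArensMichael H) :
    ∃ l : PTensor ℂ H →A[ℂ] H, ∀ (c : ℂ) (a : H), l (ptmul c a) = c • a := by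
  refine ⟨PTensor.algLift hH (ContinuousAlgHom.unit H) (ContinuousAlgHom.id ℂ H)
    fun c a => Algebra.commutes c a, fun c a => ?_⟩
  refine (PTensor.algLift_ptmul hH _ _ _ c a).trans ?_
  rw [Algebra.smul_def]
  rfl

/-- The canonical homomorphism `a ⊗ c ↦ c a`. -/
theorem PTensor.exists_rid (hH : IsArensMichael H) :
    ∃ r : PTensor H ℂ →A[ℂ] H, ∀ (a : H) (c : ℂ), r (ptmul a c) = c • a := by
  refine ⟨PTensor.algLift hH (ContinuousAlgHom.id ℂ H) (ContinuousAlgHom.unit H)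
    fun a c => (Algebra.commutes c a).symm, fun a c => ?_⟩
  refine (PTensor.algLift_ptmul hH _ _ _ a c).trans ?_
  rw [Algebra.smul_def, Algebra.commutes]
  rfl

/-- The linearized multiplication. -/
theorem PTensor.exists_mul (hH : IsArensMichael H) :
    ∃ m : PTensor H H →L[ℂ] H, ∀ a b : H, m (ptmul a b) = a * b :=
  have := hH.t2
  have := hH.complete
  have : PolynormableSpace ℂ H := hH.withSeminorms.toPolynormableSpace
  ⟨PTensor.lift (LinearMap.mul ℂ H) continuous_mul, PTensor.lift_ptmul _ _⟩

omit [IsUniformAddGroup H] in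
/-- If the left antipode identity holds at `h` and `k`, then it holds at `h * k`: for fixed `u`
with `m (S ⊗ id) u = c`, the antimultiplicativity of `S` gives
`m (S ⊗ id) (u * v) = c m (S ⊗ id) v` first on elementary tensors `v`. -/
theorem PTensor.mul_map_left_mul [T2Space H] {m : PTensor H H →L[ℂ] H}
    (hm : ∀ a b, m (ptmul a b) = a * b) {S : H →L[ℂ] H} (hS : ∀ a b, S (a * b) = S b * S a)
    {u : PTensor H H} {c : ℂ}
    (hu : m (PTensor.map S (ContinuousLinearMap.id ℂ H) u) = algebraMap ℂ H c) (v : PTensor H H) :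
    m (PTensor.map S (ContinuousLinearMap.id ℂ H) (u * v)) =
      algebraMap ℂ H c * m (PTensor.map S (ContinuousLinearMap.id ℂ H) v) := by
  have key : ∀ (b d : H) (u : PTensor H H),
      m (PTensor.map S (ContinuousLinearMap.id ℂ H) (u * ptmul b d)) =
        S b * m (PTensor.map S (ContinuousLinearMap.id ℂ H) u) * d := by
    intro b d u
    induction u using PTensor.induction_on with
    | hc => exact isClosed_eq (by fun_prop) (by fun_prop)
    | h0 => simp
    | ht a a' =>
      simp only [ptmul_mul_ptmul, PTensor.map_ptmul, hm, hS, ContinuousLinearMap.id_apply,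
        mul_assoc]
    | ha u u' hu hu' => rw [add_mul, map_add, map_add, hu, hu', map_add, map_add, mul_add, add_mul]
  induction v using PTensor.induction_on with
  | hc => exact isClosed_eq (by fun_prop) (by fun_prop)
  | h0 => simp
  | ht a a' =>
    rw [key, hu, ← Algebra.commutes, PTensor.map_ptmul, hm, mul_assoc]
    rfl
  | ha v v' hv hv' => rw [mul_add, map_add, map_add, hv, hv', map_add, map_add, mul_add]

omit [IsUniformAddGroup H] in
/-- If the right antipode identity holds at `h` and `k`, then it holds at `h * k`; compare
`PTensor.mul_map_left_mul`. -/
theorem PTensor.mul_map_right_mul [T2Space H] {m : PTensor H H →L[ℂ] H}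
    (hm : ∀ a b, m (ptmul a b) = a * b) {S : H →L[ℂ] H} (hS : ∀ a b, S (a * b) = S b * S a)
    {v : PTensor H H} {c : ℂ}
    (hv : m (PTensor.map (ContinuousLinearMap.id ℂ H) S v) = algebraMap ℂ H c) (u : PTensor H H) :
    m (PTensor.map (ContinuousLinearMap.id ℂ H) S (u * v)) =
      m (PTensor.map (ContinuousLinearMap.id ℂ H) S u) * algebraMap ℂ H c := by
  have key : ∀ (b d : H) (v : PTensor H H),
      m (PTensor.map (ContinuousLinearMap.id ℂ H) S (ptmul b d * v)) =
        b * m (PTensor.map (ContinuousLinearMap.id ℂ H) S v) * S d := by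
    intro b d v
    induction v using PTensor.induction_on with
    | hc => exact isClosed_eq (by fun_prop) (by fun_prop)
    | h0 => simp
    | ht a a' =>
      simp only [ptmul_mul_ptmul, PTensor.map_ptmul, hm, hS, ContinuousLinearMap.id_apply,
        mul_assoc]
    | ha v v' hv hv' => rw [mul_add, map_add, map_add, hv, hv', map_add, map_add, mul_add, add_mul]
  induction u using PTensor.induction_on with
  | hc => exact isClosed_eq (by fun_prop) (by fun_prop)
  | h0 => simp
  | ht a a' =>
    rw [key, hv, PTensor.map_ptmul, hm, mul_assoc, Algebra.commutes, ← mul_assoc]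
    rfl
  | ha u u' hu hu' => rw [add_mul, map_add, map_add, hu, hu', map_add, map_add, add_mul]

end PTensorStructure

/-! ### The Hopf structure -/

namespace UAf

open NormedSpace

variable {ħ : ℂ}

/-- A closed property that is inherited by linear combinations and products holds everywhere if it
holds for `1`, `X` and `Y`. -/
@[elab_as_elim]
theorem induction_on {P : UAf ħ → Prop} (a : UAf ħ) (closed : IsClosed {a | P a}) (one : P 1)
    (X : P (X ħ)) (Y : P (Y ħ)) (smul : ∀ (c : ℂ) a, P a → P (c • a))
    (add : ∀ a b, P a → P b → P (a + b)) (mul : ∀ a b, P a → P b → P (a * b)) : P a :=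
  subalgebra_eq_top
    { carrier := {a | P a}
      mul_mem' := fun {a b} ha hb => mul a b ha hb
      add_mem' := fun {a b} ha hb => add a b ha hb
      algebraMap_mem' := fun c => by
        rw [Algebra.algebraMap_eq_smul_one]
        exact smul c 1 one } closed X Y a

variable (ħ) in
theorem isArensMichael_tensor : IsArensMichael (PTensor (UAf ħ) (UAf ħ)) :=
  IsLocallyMConvex.isArensMichael_pTensor (isArensMichael ħ).withSeminorms
    (isArensMichael ħ).withSeminorms

/-! ### Comultiplication and counit -/

/-- As `Y` is primitive, its exponentials are group-like. -/
theorem exp_smul_primitive (c : ℂ) :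
    exp (c • (ptmul 1 (Y ħ) + ptmul (Y ħ) 1)) = ptmul (exp (c • Y ħ)) (exp (c • Y ħ)) := by
  have hc : Commute (ptmul 1 (c • Y ħ)) (ptmul (c • Y ħ) 1) := by
    simp [Commute, SemiconjBy, ptmul_mul_ptmul]
  rw [smul_add, ← ptmul_smul_left c (Y ħ) 1, ← ptmul_smul_right c 1 (Y ħ),
    (isArensMichael_tensor ħ).exp_add_of_commute hc, ← PTensor.includeLeft_apply,
    ← PTensor.includeRight_apply, ← (isArensMichael ħ).map_exp, ← (isArensMichael ħ).map_exp,
    PTensor.includeLeft_apply, PTensor.includeRight_apply, ptmul_mul_ptmul, one_mul, mul_one]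

theorem commute_exp (c : ℂ) : Commute (Y ħ) (exp (c • Y ħ)) :=
  ((Commute.refl (Y ħ)).smul_right c).exp_right

/-- With `e = exp (ħ Y)`, `e' = exp (-ħ Y)` and `s = [X, Y]`, the commutator of the two elements is
`s ⊗ e' + e ⊗ s`; as `s` is a multiple of `e - e'`, the mixed terms `e ⊗ e'` cancel and the same
multiple of `e ⊗ e - e' ⊗ e'` remains. -/
theorem afRelation_comul :
    AfRelation ħ (ptmul (X ħ) (exp (-(ħ • Y ħ))) + ptmul (exp (ħ • Y ħ)) (X ħ))
      (ptmul 1 (Y ħ) + ptmul (Y ħ) 1) := by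
  have h := afRelation ħ
  have e1 := (commute_exp (ħ := ħ) ħ).eq
  have e2 := (commute_exp (ħ := ħ) (-ħ)).eq
  rw [AfRelation, algSinh] at h ⊢
  have hneg : -(ħ • (ptmul 1 (Y ħ) + ptmul (Y ħ) 1)) = (-ħ) • (ptmul 1 (Y ħ) + ptmul (Y ħ) 1) :=
    (neg_smul _ _).symm
  rw [hneg, exp_smul_primitive, exp_smul_primitive]
  simp only [← neg_smul] at h ⊢
  have key : (ptmul (X ħ) (exp (-ħ • Y ħ)) + ptmul (exp (ħ • Y ħ)) (X ħ)) *
        (ptmul 1 (Y ħ) + ptmul (Y ħ) 1) -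
      (ptmul 1 (Y ħ) + ptmul (Y ħ) 1) *
        (ptmul (X ħ) (exp (-ħ • Y ħ)) + ptmul (exp (ħ • Y ħ)) (X ħ)) =
      ptmul (X ħ * Y ħ - Y ħ * X ħ) (exp (-ħ • Y ħ)) +
        ptmul (exp (ħ • Y ħ)) (X ħ * Y ħ - Y ħ * X ħ) := by
    simp only [mul_add, add_mul, ptmul_mul_ptmul, mul_one, one_mul, ptmul_sub_left,
      ptmul_sub_right, e1, e2]
    abel
  rw [key, h]
  simp only [ptmul_smul_left, ptmul_smul_right, ptmul_sub_left, ptmul_sub_right]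
  refine (smul_add _ _ _).symm.trans (congrArg _ ((smul_add _ _ _).symm.trans (congrArg _ ?_)))
  abel

variable (ħ) in
theorem exists_comul : ∃ Δ : UAf ħ →A[ℂ] PTensor (UAf ħ) (UAf ħ),
    Δ (X ħ) = ptmul (X ħ) (exp (-(ħ • Y ħ))) + ptmul (exp (ħ • Y ħ)) (X ħ) ∧
    Δ (Y ħ) = ptmul 1 (Y ħ) + ptmul (Y ħ) 1 :=
  exists_lift (isArensMichael_tensor ħ) afRelation_comul

variable (ħ) in
theorem exists_counit : ∃ ε : UAf ħ →A[ℂ] ℂ, ε (X ħ) = 0 ∧ ε (Y ħ) = 0 :=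
  exists_lift isArensMichael_complex (by simp [AfRelation, algSinh_zero])

theorem counit_exp {ε : UAf ħ →A[ℂ] ℂ} (hY : ε (Y ħ) = 0) (c : ℂ) : ε (exp (c • Y ħ)) = 1 := by
  rw [(isArensMichael ħ).map_exp, map_smul, hY, smul_zero, exp_zero]

theorem comul_exp {Δ : UAf ħ →A[ℂ] PTensor (UAf ħ) (UAf ħ)}
    (hY : Δ (Y ħ) = ptmul 1 (Y ħ) + ptmul (Y ħ) 1) (c : ℂ) :
    Δ (exp (c • Y ħ)) = ptmul (exp (c • Y ħ)) (exp (c • Y ħ)) := by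
  rw [(isArensMichael ħ).map_exp, map_smul, hY, exp_smul_primitive]

/-- Both composites are continuous homomorphisms, so it suffices to compare them at `X` and `Y`. -/
theorem coassoc {Δ : UAf ħ →A[ℂ] PTensor (UAf ħ) (UAf ħ)}
    (hX : Δ (X ħ) = ptmul (X ħ) (exp (-(ħ • Y ħ))) + ptmul (exp (ħ • Y ħ)) (X ħ))
    (hY : Δ (Y ħ) = ptmul 1 (Y ħ) + ptmul (Y ħ) 1) :
    ∃ α : PTensor (PTensor (UAf ħ) (UAf ħ)) (UAf ħ) →L[ℂ]
        PTensor (UAf ħ) (PTensor (UAf ħ) (UAf ħ)),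
      (∀ a b c : UAf ħ, α (ptmul (ptmul a b) c) = ptmul a (ptmul b c)) ∧
      ∀ h, α (PTensor.map Δ.toContinuousLinearMap (ContinuousLinearMap.id ℂ (UAf ħ)) (Δ h)) =
        PTensor.map (ContinuousLinearMap.id ℂ (UAf ħ)) Δ.toContinuousLinearMap (Δ h) := by
  have hA := (isArensMichael ħ).withSeminorms
  have hT := (isArensMichael_tensor ħ).withSeminorms
  obtain ⟨α, hα⟩ := PTensor.exists_assoc hA hA hA
  obtain ⟨φ, hφ⟩ := PTensor.exists_algHom_eq_map Δ (ContinuousAlgHom.id ℂ (UAf ħ))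
    (IsLocallyMConvex.isArensMichael_pTensor hT hA)
  obtain ⟨ψ, hψ⟩ := PTensor.exists_algHom_eq_map (ContinuousAlgHom.id ℂ (UAf ħ)) Δ
    (IsLocallyMConvex.isArensMichael_pTensor hA hT)
  have hφ' : ∀ a b, φ (ptmul a b) = ptmul (Δ a) b := fun a b =>
    (hφ _).trans (PTensor.map_ptmul _ _ _ _)
  have hψ' : ∀ a b, ψ (ptmul a b) = ptmul a (Δ b) := fun a b =>
    (hψ _).trans (PTensor.map_ptmul _ _ _ _)
  have key : α.comp (φ.comp Δ) = ψ.comp Δ := by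
    refine algHom_ext ?_ ?_
    · change α (φ (Δ _)) = ψ (Δ _)
      rw [hX, ← neg_smul]
      simp only [map_add, hφ', hψ', comul_exp hY, hX, ptmul_add_left, ptmul_add_right, hα,
        ← neg_smul]
      abel
    · change α (φ (Δ _)) = ψ (Δ _)
      rw [hY]
      simp only [map_add, hφ', hψ', hY, map_one, ptmul_add_left, ptmul_add_right, hα]
      rw [← ptmul_one_one, hα]
      abel
  refine ⟨α.toContinuousLinearMap, hα, fun h => ?_⟩
  have := DFunLike.congr_fun key h
  change α (φ (Δ h)) = ψ (Δ h) at this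
  rw [hφ, hψ] at this
  exact this

theorem counit_left {Δ : UAf ħ →A[ℂ] PTensor (UAf ħ) (UAf ħ)} {ε : UAf ħ →A[ℂ] ℂ}
    (hX : Δ (X ħ) = ptmul (X ħ) (exp (-(ħ • Y ħ))) + ptmul (exp (ħ • Y ħ)) (X ħ))
    (hY : Δ (Y ħ) = ptmul 1 (Y ħ) + ptmul (Y ħ) 1) (hεX : ε (X ħ) = 0) (hεY : ε (Y ħ) = 0) :
    ∃ l : PTensor ℂ (UAf ħ) →L[ℂ] UAf ħ, (∀ (c : ℂ) (a : UAf ħ), l (ptmul c a) = c • a) ∧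
      ∀ h, l (PTensor.map ε.toContinuousLinearMap
        (ContinuousLinearMap.id ℂ (UAf ħ)) (Δ h)) = h := by
  have hA := (isArensMichael ħ).withSeminorms
  obtain ⟨l, hl⟩ := PTensor.exists_lid (isArensMichael ħ)
  obtain ⟨φ, hφ⟩ := PTensor.exists_algHom_eq_map ε (ContinuousAlgHom.id ℂ (UAf ħ))
    (IsLocallyMConvex.isArensMichael_pTensor isArensMichael_complex.withSeminorms hA)
  have hφ' : ∀ a b, φ (ptmul a b) = ptmul (ε a) b := fun a b =>
    (hφ _).trans (PTensor.map_ptmul _ _ _ _)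
  have key : l.comp (φ.comp Δ) = ContinuousAlgHom.id ℂ (UAf ħ) := by
    refine algHom_ext ?_ ?_
    · change l (φ (Δ _)) = X ħ
      rw [hX, map_add, map_add, hφ', hφ', hl, hl, hεX, counit_exp hεY, zero_smul, one_smul,
        zero_add]
    · change l (φ (Δ _)) = Y ħ
      rw [hY, map_add, map_add, hφ', hφ', hl, hl, hεY, map_one, zero_smul, one_smul, add_zero]
  refine ⟨l.toContinuousLinearMap, hl, fun h => ?_⟩
  have := DFunLike.congr_fun key h
  change l (φ (Δ h)) = h at this
  rw [hφ] at this
  exact this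

theorem counit_right {Δ : UAf ħ →A[ℂ] PTensor (UAf ħ) (UAf ħ)} {ε : UAf ħ →A[ℂ] ℂ}
    (hX : Δ (X ħ) = ptmul (X ħ) (exp (-(ħ • Y ħ))) + ptmul (exp (ħ • Y ħ)) (X ħ))
    (hY : Δ (Y ħ) = ptmul 1 (Y ħ) + ptmul (Y ħ) 1) (hεX : ε (X ħ) = 0) (hεY : ε (Y ħ) = 0) :
    ∃ r : PTensor (UAf ħ) ℂ →L[ℂ] UAf ħ, (∀ (a : UAf ħ) (c : ℂ), r (ptmul a c) = c • a) ∧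
      ∀ h, r (PTensor.map (ContinuousLinearMap.id ℂ (UAf ħ))
        ε.toContinuousLinearMap (Δ h)) = h := by
  have hA := (isArensMichael ħ).withSeminorms
  obtain ⟨r, hr⟩ := PTensor.exists_rid (isArensMichael ħ)
  obtain ⟨φ, hφ⟩ := PTensor.exists_algHom_eq_map (ContinuousAlgHom.id ℂ (UAf ħ)) ε
    (IsLocallyMConvex.isArensMichael_pTensor hA isArensMichael_complex.withSeminorms)
  have hφ' : ∀ a b, φ (ptmul a b) = ptmul a (ε b) := fun a b =>
    (hφ _).trans (PTensor.map_ptmul _ _ _ _)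
  have key : r.comp (φ.comp Δ) = ContinuousAlgHom.id ℂ (UAf ħ) := by
    refine algHom_ext ?_ ?_
    · change r (φ (Δ _)) = X ħ
      rw [hX, map_add, map_add, hφ', hφ', hr, hr, hεX, ← neg_smul, counit_exp hεY, zero_smul,
        one_smul, add_zero]
    · change r (φ (Δ _)) = Y ħ
      rw [hY, map_add, map_add, hφ', hφ', hr, hr, hεY, map_one, zero_smul, one_smul, zero_add]
  refine ⟨r.toContinuousLinearMap, hr, fun h => ?_⟩
  have := DFunLike.congr_fun key h
  change r (φ (Δ h)) = h at this
  rw [hφ] at this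
  exact this

/-! ### Antipode -/

/-- For each `c`, there is a continuous antiendomorphism with `X ↦ -X + c sinh (ħ Y)`,
`Y ↦ -Y`. -/
theorem exists_antihom (c : ℂ) : ∃ S : UAf ħ →L[ℂ] UAf ħ, S 1 = 1 ∧
    (∀ a b, S (a * b) = S b * S a) ∧ S (X ħ) = -X ħ + c • algSinh (ħ • Y ħ) ∧ S (Y ħ) = -Y ħ := by
  have hc : Commute (Y ħ) (algSinh (ħ • Y ħ)) := by
    rw [algSinh, ← neg_smul]
    exact ((commute_exp ħ).sub_right (commute_exp (-ħ))).smul_right _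
  have hrel : AfRelation ħ (MulOpposite.op (-X ħ + c • algSinh (ħ • Y ħ)))
      (MulOpposite.op (-Y ħ)) := by
    have h := afRelation ħ
    rw [AfRelation] at h ⊢
    have hop : algSinh (ħ • MulOpposite.op (-Y ħ)) = MulOpposite.op (-algSinh (ħ • Y ħ)) := by
      rw [← algSinh_neg, ← smul_neg, algSinh, algSinh, ← MulOpposite.op_smul, ← MulOpposite.op_neg,
        exp_op, exp_op, ← MulOpposite.op_sub, ← MulOpposite.op_smul]
    rw [hop, ← MulOpposite.op_mul, ← MulOpposite.op_mul, ← MulOpposite.op_sub,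
      ← MulOpposite.op_smul, smul_neg, ← h]
    congr 1
    rw [mul_add, add_mul, mul_smul_comm, smul_mul_assoc, neg_mul (Y ħ) (algSinh _),
      mul_neg (algSinh _), hc.eq]
    noncomm_ring
  obtain ⟨φ, hX, hY⟩ := exists_lift (isArensMichael ħ).mulOpposite hrel
  refine ⟨(MulOpposite.opContinuousLinearEquiv ℂ (M := UAf ħ)).symm.toContinuousLinearMap.comp
    φ.toContinuousLinearMap, ?_, ?_, ?_, ?_⟩
  · change (φ 1).unop = 1
    rw [map_one, MulOpposite.unop_one]
  · intro a b
    change (φ (a * b)).unop = (φ b).unop * (φ a).unop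
    rw [map_mul, MulOpposite.unop_mul]
  · change (φ _).unop = _
    rw [hX, MulOpposite.unop_op]
  · change (φ _).unop = _
    rw [hY, MulOpposite.unop_op]

theorem antihom_exp {S : UAf ħ →L[ℂ] UAf ħ} (h1 : S 1 = 1)
    (hS : ∀ a b, S (a * b) = S b * S a) (x : UAf ħ) : S (exp x) = exp (S x) := by
  have hpow : ∀ n : ℕ, S (x ^ n) = S x ^ n := by
    intro n
    induction n with
    | zero => simpa using h1
    | succ n ih => rw [pow_succ, hS, ih, pow_succ']
  have h := ((isArensMichael ħ).hasSum_exp x).map S S.continuous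
  refine h.unique ?_
  convert (isArensMichael ħ).hasSum_exp (S x) using 2 with n
  rw [Function.comp_apply, map_smul, hpow]

theorem antihom_algSinh {S : UAf ħ →L[ℂ] UAf ħ} (h1 : S 1 = 1)
    (hS : ∀ a b, S (a * b) = S b * S a) (hY : S (Y ħ) = -Y ħ) :
    S (algSinh (ħ • Y ħ)) = -algSinh (ħ • Y ħ) := by
  rw [← algSinh_neg]
  simp only [algSinh, map_smul, map_sub, map_neg, antihom_exp h1 hS, hY, smul_neg]

theorem antihom_ext {S S' : UAf ħ →L[ℂ] UAf ħ} (h1 : S 1 = 1) (h1' : S' 1 = 1)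
    (hS : ∀ a b, S (a * b) = S b * S a) (hS' : ∀ a b, S' (a * b) = S' b * S' a)
    (hX : S' (X ħ) = S (X ħ)) (hY : S' (Y ħ) = S (Y ħ)) : S' = S := by
  ext a
  induction a using UAf.induction_on with
  | closed => exact isClosed_eq S'.continuous S.continuous
  | one => rw [h1, h1']
  | X => exact hX
  | Y => exact hY
  | smul c a ha => rw [map_smul, map_smul, ha]
  | add a b ha hb => rw [map_add, map_add, ha, hb]
  | mul a b ha hb => rw [hS, hS', ha, hb]

/-- The antiendomorphisms with parameters `c` and `-c` are mutually inverse. -/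
theorem antihom_antihom {c : ℂ} {S T : UAf ħ →L[ℂ] UAf ħ} (hS1 : S 1 = 1)
    (hS : ∀ a b, S (a * b) = S b * S a) (hSX : S (X ħ) = -X ħ + c • algSinh (ħ • Y ħ))
    (hSY : S (Y ħ) = -Y ħ) (hT1 : T 1 = 1)
    (hT : ∀ a b, T (a * b) = T b * T a) (hTX : T (X ħ) = -X ħ + (-c) • algSinh (ħ • Y ħ))
    (hTY : T (Y ħ) = -Y ħ) (a : UAf ħ) : S (T a) = a := by
  induction a using UAf.induction_on with
  | closed => exact isClosed_eq (S.continuous.comp T.continuous) continuous_id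
  | one => rw [hT1, hS1]
  | X =>
    rw [hTX, map_add, map_neg, map_smul, hSX, antihom_algSinh hS1 hS hSY]
    module
  | Y => rw [hTY, map_neg, hSY, neg_neg]
  | smul c a ha => rw [map_smul, map_smul, ha]
  | add a b ha hb => rw [map_add, map_add, ha, hb]
  | mul a b ha hb => rw [hT, hS, ha, hb]

variable (ħ) in
/-- The antipode is the antiendomorphism with parameter `-ħ / sinh ħ`. -/
theorem exists_antipode : ∃ S : UAf ħ ≃L[ℂ] UAf ħ, S 1 = 1 ∧ (∀ a b, S (a * b) = S b * S a) ∧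
    S (X ħ) = -X ħ - (ħ / Complex.sinh ħ) • algSinh (ħ • Y ħ) ∧ S (Y ħ) = -Y ħ := by
  obtain ⟨S, hS1, hS, hSX, hSY⟩ := exists_antihom (ħ := ħ) (-(ħ / Complex.sinh ħ))
  obtain ⟨T, hT1, hT, hTX, hTY⟩ := exists_antihom (ħ := ħ) (ħ / Complex.sinh ħ)
  refine ⟨ContinuousLinearEquiv.equivOfInverse S T
    (antihom_antihom hT1 hT hTX hTY hS1 hS hSX hSY)
    (antihom_antihom hS1 hS hSX hSY hT1 hT (by rw [neg_neg]; exact hTX) hTY), hS1, hS, ?_, hSY⟩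
  rw [sub_eq_add_neg, ← neg_smul]
  exact hSX

/-- The commutation rule `exp (-ħ Y) X = (X + ħ sinh (ħ Y) / sinh ħ) exp (-ħ Y)`. -/
theorem exp_neg_mul_X : exp (-(ħ • Y ħ)) * X ħ =
    (X ħ + (ħ / Complex.sinh ħ) • algSinh (ħ • Y ħ)) * exp (-(ħ • Y ħ)) := by
  have hc : Commute (Y ħ) (algSinh (ħ • Y ħ)) := by
    rw [algSinh, ← neg_smul]
    exact ((commute_exp ħ).sub_right (commute_exp (-ħ))).smul_right _
  have hs : X ħ * (-(ħ • Y ħ)) - (-(ħ • Y ħ)) * X ħ =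
      -((ħ / Complex.sinh ħ) • algSinh (ħ • Y ħ)) := by
    have h := afRelation ħ
    rw [AfRelation] at h
    rw [div_eq_mul_inv, mul_smul, ← h, mul_neg, neg_mul, mul_smul_comm, smul_mul_assoc, smul_sub]
    abel
  have hc' : Commute (-(ħ • Y ħ)) (-((ħ / Complex.sinh ħ) • algSinh (ħ • Y ħ))) :=
    ((hc.smul_left ħ).smul_right _).neg_left.neg_right
  have h := (isArensMichael ħ).mul_exp_sub_exp_mul hs hc'
  have h2 : Commute (exp (-(ħ • Y ħ))) (-((ħ / Complex.sinh ħ) • algSinh (ħ • Y ħ))) :=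
    hc'.exp_left
  rw [h2.eq, neg_mul] at h
  rw [sub_eq_iff_eq_add] at h
  rw [add_mul, h]
  abel

/-- By `PTensor.mul_map_left_mul`, the identity is inherited by products, so it suffices to check
it at `X` and `Y`. -/
theorem antipode_left {Δ : UAf ħ →A[ℂ] PTensor (UAf ħ) (UAf ħ)} {ε : UAf ħ →A[ℂ] ℂ}
    (hX : Δ (X ħ) = ptmul (X ħ) (exp (-(ħ • Y ħ))) + ptmul (exp (ħ • Y ħ)) (X ħ))
    (hY : Δ (Y ħ) = ptmul 1 (Y ħ) + ptmul (Y ħ) 1) (hεX : ε (X ħ) = 0) (hεY : ε (Y ħ) = 0)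
    {S : UAf ħ →L[ℂ] UAf ħ} (hS1 : S 1 = 1) (hS : ∀ a b, S (a * b) = S b * S a)
    (hSX : S (X ħ) = -X ħ - (ħ / Complex.sinh ħ) • algSinh (ħ • Y ħ)) (hSY : S (Y ħ) = -Y ħ)
    {m : PTensor (UAf ħ) (UAf ħ) →L[ℂ] UAf ħ} (hm : ∀ a b, m (ptmul a b) = a * b) (h : UAf ħ) :
    m (PTensor.map S (ContinuousLinearMap.id ℂ (UAf ħ)) (Δ h)) = algebraMap ℂ (UAf ħ) (ε h) := by
  induction h using UAf.induction_on with
  | closed => exact isClosed_eq (by fun_prop) ((continuous_algebraMap ℂ _).comp ε.continuous)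
  | one =>
    rw [map_one Δ, map_one ε, map_one (algebraMap ℂ _), ← ptmul_one_one, PTensor.map_ptmul, hm,
      hS1]
    exact one_mul 1
  | X =>
    rw [hX, map_add, map_add, PTensor.map_ptmul, PTensor.map_ptmul, hm, hm, hεX, map_zero,
      antihom_exp hS1 hS, map_smul, hSY, hSX, smul_neg, ContinuousLinearMap.id_apply,
      ContinuousLinearMap.id_apply, exp_neg_mul_X, ← add_mul]
    simp
  | Y =>
    rw [hY, map_add, map_add, PTensor.map_ptmul, PTensor.map_ptmul, hm, hm, hεY, map_zero, hS1,
      hSY]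
    simp
  | smul c a ha => rw [map_smul, map_smul, map_smul, map_smul, ha, smul_eq_mul, map_mul,
      Algebra.smul_def]
  | add a b ha hb => rw [map_add, map_add, map_add, map_add, ha, hb, map_add]
  | mul a b ha hb => rw [map_mul, PTensor.mul_map_left_mul hm hS ha, hb, map_mul, map_mul]

/-- At `X`, the identity amounts to `S X = -exp (-ħ Y) X exp (ħ Y)`. -/
theorem antipode_right {Δ : UAf ħ →A[ℂ] PTensor (UAf ħ) (UAf ħ)} {ε : UAf ħ →A[ℂ] ℂ}
    (hX : Δ (X ħ) = ptmul (X ħ) (exp (-(ħ • Y ħ))) + ptmul (exp (ħ • Y ħ)) (X ħ))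
    (hY : Δ (Y ħ) = ptmul 1 (Y ħ) + ptmul (Y ħ) 1) (hεX : ε (X ħ) = 0) (hεY : ε (Y ħ) = 0)
    {S : UAf ħ →L[ℂ] UAf ħ} (hS1 : S 1 = 1) (hS : ∀ a b, S (a * b) = S b * S a)
    (hSX : S (X ħ) = -X ħ - (ħ / Complex.sinh ħ) • algSinh (ħ • Y ħ)) (hSY : S (Y ħ) = -Y ħ)
    {m : PTensor (UAf ħ) (UAf ħ) →L[ℂ] UAf ħ} (hm : ∀ a b, m (ptmul a b) = a * b) (h : UAf ħ) :
    m (PTensor.map (ContinuousLinearMap.id ℂ (UAf ħ)) S (Δ h)) = algebraMap ℂ (UAf ħ) (ε h) := by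
  induction h using UAf.induction_on with
  | closed => exact isClosed_eq (by fun_prop) ((continuous_algebraMap ℂ _).comp ε.continuous)
  | one =>
    rw [map_one Δ, map_one ε, map_one (algebraMap ℂ _), ← ptmul_one_one, PTensor.map_ptmul, hm,
      hS1]
    exact one_mul 1
  | X =>
    have e : S (X ħ) = -(exp (-(ħ • Y ħ)) * X ħ * exp (ħ • Y ħ)) := by
      rw [exp_neg_mul_X, mul_assoc, (isArensMichael ħ).exp_neg_mul_exp, mul_one, hSX]
      abel
    rw [hX, map_add, map_add, PTensor.map_ptmul, PTensor.map_ptmul, hm, hm, hεX, map_zero,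
      antihom_exp hS1 hS, map_neg, map_smul, hSY, smul_neg, neg_neg, e,
      ContinuousLinearMap.id_apply, ContinuousLinearMap.id_apply, mul_neg, ← mul_assoc,
      ← mul_assoc, (isArensMichael ħ).exp_mul_exp_neg, one_mul, add_neg_cancel]
  | Y =>
    rw [hY, map_add, map_add, PTensor.map_ptmul, PTensor.map_ptmul, hm, hm, hεY, map_zero, hS1,
      hSY]
    simp
  | smul c a ha => rw [map_smul, map_smul, map_smul, map_smul, ha, smul_eq_mul, map_mul,
      Algebra.smul_def]
  | add a b ha hb => rw [map_add, map_add, map_add, map_add, ha, hb, map_add]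
  | mul a b ha hb => rw [map_mul, PTensor.mul_map_right_mul hm hS hb, ha, map_mul, map_mul]

end UAf

end

theorem proposition5p6 (ħ : ℂ) (hħ : Complex.sinh ħ ≠ 0) :
    -- `UAf ħ` is the universal HFG algebra with generators `X`, `Y` and the given relation
    IsHFG (UAf ħ) ∧
    IsHolomorphicallyGenerated ![UAf.X ħ, UAf.Y ħ] ∧
    AfRelation ħ (UAf.X ħ) (UAf.Y ħ) ∧
    (∀ (B : Type*) [Ring B] [Algebra ℂ B] [UniformSpace B] [IsUniformAddGroup B]
      [IsTopologicalRing B], IsArensMichael B → ∀ x y : B, AfRelation ħ x y →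
        ∃! φ : UAf ħ →A[ℂ] B, φ (UAf.X ħ) = x ∧ φ (UAf.Y ħ) = y) ∧
    -- it is infinite-dimensional
    ¬ FiniteDimensional ℂ (UAf ħ) ∧
    -- Hopf structure; the antipode is an isomorphism
    ∃ (Δ : UAf ħ →A[ℂ] PTensor (UAf ħ) (UAf ħ)) (ε : UAf ħ →A[ℂ] ℂ) (S : UAf ħ ≃L[ℂ] UAf ħ),
      IsHopfPTensorAlgebra Δ ε (S : UAf ħ →L[ℂ] UAf ħ) ∧
      -- the values on the generators
      Δ (UAf.X ħ) = ptmul (UAf.X ħ) (NormedSpace.exp (-(ħ • UAf.Y ħ)))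
        + ptmul (NormedSpace.exp (ħ • UAf.Y ħ)) (UAf.X ħ) ∧
      Δ (UAf.Y ħ) = ptmul 1 (UAf.Y ħ) + ptmul (UAf.Y ħ) 1 ∧
      ε (UAf.X ħ) = 0 ∧
      ε (UAf.Y ħ) = 0 ∧
      S 1 = 1 ∧
      (∀ a b, S (a * b) = S b * S a) ∧
      S (UAf.X ħ) = -UAf.X ħ - (ħ / Complex.sinh ħ) • algSinh (ħ • UAf.Y ħ) ∧
      S (UAf.Y ħ) = -UAf.Y ħ ∧
      -- these values determine the three operations
      (∀ Δ' : UAf ħ →A[ℂ] PTensor (UAf ħ) (UAf ħ),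
        Δ' (UAf.X ħ) = Δ (UAf.X ħ) → Δ' (UAf.Y ħ) = Δ (UAf.Y ħ) → Δ' = Δ) ∧
      (∀ ε' : UAf ħ →A[ℂ] ℂ, ε' (UAf.X ħ) = 0 → ε' (UAf.Y ħ) = 0 → ε' = ε) ∧
      (∀ S' : UAf ħ →L[ℂ] UAf ħ, S' 1 = 1 → (∀ a b, S' (a * b) = S' b * S' a) →
        S' (UAf.X ħ) = S (UAf.X ħ) → S' (UAf.Y ħ) = S (UAf.Y ħ) →
        S' = (S : UAf ħ →L[ℂ] UAf ħ)) := by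
  obtain ⟨Δ, hX, hY⟩ := UAf.exists_comul ħ
  obtain ⟨ε, hεX, hεY⟩ := UAf.exists_counit ħ
  obtain ⟨S, hS1, hS, hSX, hSY⟩ := UAf.exists_antipode ħ
  obtain ⟨m, hm⟩ := PTensor.exists_mul (UAf.isArensMichael ħ)
  refine ⟨UAf.isHFG ħ, UAf.isHolomorphicallyGenerated ħ, UAf.afRelation ħ, ?_,
    UAf.not_finiteDimensional, Δ, ε, S, ?_, hX, hY, hεX, hεY, hS1, hS, hSX, hSY, ?_, ?_, ?_⟩
  · intro B _ _ _ _ _ hB x y h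
    exact UAf.existsUnique_lift hB h
  · exact
      { t2 := inferInstance
        complete := inferInstance
        locallyConvex := inferInstance
        coassoc := UAf.coassoc hX hY
        counit_left := UAf.counit_left hX hY hεX hεY
        counit_right := UAf.counit_right hX hY hεX hεY
        antipode := ⟨m, hm, UAf.antipode_left hX hY hεX hεY hS1 hS hSX hSY hm,
          UAf.antipode_right hX hY hεX hεY hS1 hS hSX hSY hm⟩ }
  · exact fun Δ' h0 h1 => UAf.algHom_ext h0 h1
  · exact fun ε' h0 h1 => UAf.algHom_ext (h0.trans hεX.symm) (h1.trans hεY.symm)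
  · exact fun S' h1 hmul h0 h2 => UAf.antihom_ext hS1 h1 hS hmul h0 h2
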